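/- Let $n\ge 2$, $\mu\in(0,1)$, let $\Omega_0,\Omega_1\subset\mathbb R^n$ be nonempty open bounded convex sets and $\Omega_\mu=(1-\mu)\Omega_0+\mu\Omega_1$. Let $S_n$ be the space of real symmetric $n\times n$ matrices. For $i=0,1,\mu$ let $F_i:\Omega_i\times[0,\infty)\times\mathbb R^n\times S_n\to\mathbb R$ be continuous, proper ($F_i(x,t,\xi,A)\le F_i(x,s,\xi,A)$ if $t\ge s$) and degenerate elliptic ($F_i(x,t,\xi,A)\le F_i(x,t,\xi,B)$ if $A\le B$), and let $u_i$ solve $$F_i(x,u_i,Du_i,D^2u_i)=0\ \text{ and }\ u_i>0\ \text{ in }\Omega_i,\qquad u_i=0\ \text{ on }\partial\Omega_i ,\qquad(P_i)$$ where $u_0,u_1$ are classical solutions ($u_i\in C^2(\Omega_i)\cap C(\overline{\Omega_i})$). A viscosity subsolution (supersolution) of $F_\mu=0$ in $\Omega_\mu$ is an upper (lower) semicontinuous function $v$ with $F_\mu(x,v(x),D\phi(x),D^2\phi(x))\ge0$ ($\le 0$) whenever $x\in\Omega_\mu$, $\phi\in C^2(\Omega_\mu)$, $\phi(x)=v(x)$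 and $\phi\ge v$ ($\phi\le v$) near $x$; a viscosity solution is both. Assume that one of the following holds. 1. $u_\mu\in C^2(\Omega_\mu)\cap C(\overline{\Omega_\mu})$ is a classical solution of $(P_\mu)$, and $F_\mu$ satisfies the comparison principle: if $u\in C(\overline{\Omega_\mu})\cap C^2(\Omega_\mu)$ and $v\in C(\overline{\Omega_\mu})$ are nonnegative, $u$ is a classical supersolution ($F_\mu(x,u,Du,D^2u)\le 0$ in $\Omega_\mu$), $v$ is a viscosity subsolution of $F_\mu=0$ in $\Omega_\mu$, and $u\ge v$ on $\partial\Omega_\mu$, then $u\ge v$ in $\Omega_\mu$. 2. $u_\mu\in C(\overline{\Omega_\mu})$ is a viscosity solution of $(P_\mu)$, and $F_\mu$ satisfies the same comparison principle for all nonnegative viscosity supersolutions $u\in C(\overline{\Omega_\mu})$. Let $p\in[0,1)$. For $\theta\in\mathbb R^n$, $x\in\Omega_i$, $A\in S_n$ put $$G^{(\theta)}_{i,p}(x,t,A)=F_i\big(x,t^{1/p},t^{1/p-1}\theta,t^{1/p-3}A\big)\quad(t>0)\ \text{ if }p>0,\qquad G^{(\theta)}_{i,0}(x,t,A)=F_i(x,e^t,e^t\theta,e^tA)\quad(t\in\mathbb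 R),$$ and assume that for all $\theta\in\mathbb R^n$, $x_0\in\Omega_0$, $x_1\in\Omega_1$, $A_0,A_1\in S_n$ and all $t_0,t_1>0$ if $p>0$, all $t_0,t_1\in\mathbb R$ if $p=0$, $$G^{(\theta)}_{\mu,p}\big((1-\mu)x_0+\mu x_1,(1-\mu)t_0+\mu t_1,(1-\mu)A_0+\mu A_1\big)\ge\min\big\{G^{(\theta)}_{0,p}(x_0,t_0,A_0),\,G^{(\theta)}_{1,p}(x_1,t_1,A_1)\big\}.$$ If $p>0$, assume moreover that for $i=0,1$, every $x\in\partial\Omega_i$ and every inward direction $\nu$ at $x$ (that is, $x+t\nu\in\Omega_i$ for some $t>0$), $$\liminf_{\Omega_i\ni y\to x}\frac{\partial u_i}{\partial\nu}(y)>0 .$$ Then for every $r\in(0,\infty]$ one has $u_i\in L^r(\Omega_i)$ for $i=0,1,\mu$, and $$\|u_\mu\|_{L^r(\Omega_\mu)}\ \ge\ M_q\big(\|u_0\|_{L^r(\Omega_0)},\|u_1\|_{L^r(\Omega_1)};\mu\big),\qquad q=\begin{cases}\dfrac{pr}{np+r}&\text{if } r<\infty,\\[2mm] p&\text{if } r=\infty,\end{cases}$$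 where, for $a,b\ge0$, $M_q(a,b;\mu)=\big[(1-\mu)a^q+\mu b^q\big]^{1/q}$ if $q>0$ and $M_0(a,b;\mu)=a^{1-\mu}b^\mu$; for $r<1$, $\|u\|_{L^r}$ means $\big(\int|u|^r\big)^{1/r}$. -/

import Mathlib

open MeasureTheory Set Filter Topology
open scoped Pointwise ENNReal Gradient

noncomputable section

/-- `n`-dimensional Euclidean space. -/
abbrev EucSpace (n : ℕ) : Type := EuclideanSpace ℝ (Fin n)

/-- A second order operator `F(x, t, ξ, A)`. All conditions imposed below only involve its values
on `Ω × [0, ∞) × ℝⁿ × Sₙ`, where `Sₙ` is the set of symmetric matrices. -/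
abbrev SecondOrderOp (n : ℕ) : Type :=
  EucSpace n → ℝ → EucSpace n → Matrix (Fin n) (Fin n) ℝ → ℝ

/-- The `μ`-weighted `p`-mean of two nonnegative numbers, for real `p`. -/
def powMean (p a b μ : ℝ) : ℝ :=
  if p = 0 then a ^ (1 - μ) * b ^ μ
  else if p < 0 ∧ a * b = 0 then 0
  else ((1 - μ) * a ^ p + μ * b ^ p) ^ (1 / p)

/-- The Minkowski convex combination `(1 - μ) Ω₀ + μ Ω₁`. -/
def minkowskiComb {n : ℕ} (μ : ℝ) (Ω₀ Ω₁ : Set (EucSpace n)) : Set (EucSpace n) :=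
  (1 - μ) • Ω₀ + μ • Ω₁

/-- The Hessian matrix `D²u(x)` of second partial derivatives. -/
def hessianMatrix {n : ℕ} (u : EucSpace n → ℝ) (x : EucSpace n) : Matrix (Fin n) (Fin n) ℝ :=
  Matrix.of fun i j =>
    iteratedFDeriv ℝ 2 u x ![EuclideanSpace.single i 1, EuclideanSpace.single j 1]

/-- `F` is a continuous, proper, degenerate elliptic operator on `Ω × [0, ∞) × ℝⁿ × Sₙ`. -/
structure IsProperElliptic {n : ℕ} (Ω : Set (EucSpace n)) (F : SecondOrderOp n) : Prop where
  continuousOn : ContinuousOn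
    (fun z : EucSpace n × ℝ × EucSpace n × Matrix (Fin n) (Fin n) ℝ =>
      F z.1 z.2.1 z.2.2.1 z.2.2.2)
    (Ω ×ˢ (Ici 0 ×ˢ (univ ×ˢ {A | A.IsSymm})))
  proper : ∀ x ∈ Ω, ∀ s t : ℝ, 0 ≤ s → s ≤ t → ∀ (ξ : EucSpace n)
    (A : Matrix (Fin n) (Fin n) ℝ), A.IsSymm → F x t ξ A ≤ F x s ξ A
  elliptic : ∀ x ∈ Ω, ∀ t : ℝ, 0 ≤ t → ∀ (ξ : EucSpace n)
    (A B : Matrix (Fin n) (Fin n) ℝ), A.IsSymm → B.IsSymm → (B - A).PosSemidef →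
      F x t ξ A ≤ F x t ξ B

/-- Viscosity subsolution of `F = 0` in `Ω`: test functions touch from above. -/
def IsViscositySubsolution {n : ℕ} (Ω : Set (EucSpace n)) (F : SecondOrderOp n)
    (u : EucSpace n → ℝ) : Prop :=
  UpperSemicontinuousOn u Ω ∧
    ∀ φ : EucSpace n → ℝ, ContDiffOn ℝ 2 φ Ω → ∀ x ∈ Ω, φ x = u x →
      (∀ᶠ y in 𝓝 x, u y ≤ φ y) → 0 ≤ F x (u x) (∇ φ x) (hessianMatrix φ x)

/-- Viscosity supersolution of `F = 0` in `Ω`: test functions touch from below. -/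
def IsViscositySupersolution {n : ℕ} (Ω : Set (EucSpace n)) (F : SecondOrderOp n)
    (u : EucSpace n → ℝ) : Prop :=
  LowerSemicontinuousOn u Ω ∧
    ∀ φ : EucSpace n → ℝ, ContDiffOn ℝ 2 φ Ω → ∀ x ∈ Ω, φ x = u x →
      (∀ᶠ y in 𝓝 x, φ y ≤ u y) → F x (u x) (∇ φ x) (hessianMatrix φ x) ≤ 0

/-- Classical supersolution of `F = 0` in `Ω`. -/
def IsClassicalSupersolution {n : ℕ} (Ω : Set (EucSpace n)) (F : SecondOrderOp n)
    (u : EucSpace n → ℝ) : Prop :=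
  ContDiffOn ℝ 2 u Ω ∧ ∀ x ∈ Ω, F x (u x) (∇ u x) (hessianMatrix u x) ≤ 0

/-- The part of the Dirichlet problem that does not involve the equation: `u` is continuous on the
closure of `Ω`, vanishes on the boundary and is positive inside. -/
structure IsPositiveDirichlet {n : ℕ} (Ω : Set (EucSpace n)) (u : EucSpace n → ℝ) : Prop where
  continuousOn : ContinuousOn u (closure Ω)
  boundary : ∀ x ∈ frontier Ω, u x = 0
  pos : ∀ x ∈ Ω, 0 < u x

/-- Classical solution of `F(x, u, Du, D²u) = 0`, `u > 0` in `Ω`, `u = 0` on `∂Ω`. -/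
structure IsClassicalSolution {n : ℕ} (Ω : Set (EucSpace n)) (F : SecondOrderOp n)
    (u : EucSpace n → ℝ) : Prop extends IsPositiveDirichlet Ω u where
  contDiffOn : ContDiffOn ℝ 2 u Ω
  equation : ∀ x ∈ Ω, F x (u x) (∇ u x) (hessianMatrix u x) = 0

/-- Viscosity solution of `F(x, u, Du, D²u) = 0`, `u > 0` in `Ω`, `u = 0` on `∂Ω`. -/
structure IsViscositySolution {n : ℕ} (Ω : Set (EucSpace n)) (F : SecondOrderOp n)
    (u : EucSpace n → ℝ) : Prop extends IsPositiveDirichlet Ω u where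
  subsolution : IsViscositySubsolution Ω F u
  supersolution : IsViscositySupersolution Ω F u

/-- The Comparison Principle for `F` in `Ω`: classical supersolutions against viscosity
subsolutions. The functions take values in `[0, ∞)`, where `F` is defined. -/
def ComparisonPrinciple {n : ℕ} (Ω : Set (EucSpace n)) (F : SecondOrderOp n) : Prop :=
  ∀ u v : EucSpace n → ℝ,
    ContinuousOn u (closure Ω) → ContinuousOn v (closure Ω) →
    (∀ x ∈ closure Ω, 0 ≤ u x) → (∀ x ∈ closure Ω, 0 ≤ v x) →
    IsClassicalSupersolution Ω F u → IsViscositySubsolution Ω F v →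
    (∀ x ∈ frontier Ω, v x ≤ u x) → ∀ x ∈ Ω, v x ≤ u x

/-- The Comparison Principle for `F` in `Ω` with viscosity supersolutions against viscosity
subsolutions. -/
def ViscosityComparisonPrinciple {n : ℕ} (Ω : Set (EucSpace n)) (F : SecondOrderOp n) : Prop :=
  ∀ u v : EucSpace n → ℝ,
    ContinuousOn u (closure Ω) → ContinuousOn v (closure Ω) →
    (∀ x ∈ closure Ω, 0 ≤ u x) → (∀ x ∈ closure Ω, 0 ≤ v x) →
    IsViscositySupersolution Ω F u → IsViscositySubsolution Ω F v →
    (∀ x ∈ frontier Ω, v x ≤ u x) → ∀ x ∈ Ω, v x ≤ u x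

/-- The transformed operator `G_p^{(θ)}(x, t, A)`, for `p ≥ 0`. -/
def transformedOp {n : ℕ} (F : SecondOrderOp n) (p : ℝ) (θ : EucSpace n)
    (x : EucSpace n) (t : ℝ) (A : Matrix (Fin n) (Fin n) ℝ) : ℝ :=
  if p = 0 then F x (Real.exp t) (Real.exp t • θ) (Real.exp t • A)
  else F x (t ^ (1 / p)) (t ^ (1 / p - 1) • θ) (t ^ (1 / p - 3) • A)

/-- Where the variable `t` of `G_p^{(θ)}` ranges: `t = u ^ p > 0` if `p > 0`, while `t = log u` is
an arbitrary real number if `p = 0`. -/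
def transformedRange (p : ℝ) : Set ℝ := if p = 0 then univ else Ioi 0

/-- The structural assumption `(A_{μ,p})` on `F₀, F₁, Fμ`. -/
def AssumptionA {n : ℕ} (μ p : ℝ) (Ω₀ Ω₁ : Set (EucSpace n)) (F₀ F₁ Fμ : SecondOrderOp n) :
    Prop :=
  ∀ θ : EucSpace n, ∀ x₀ ∈ Ω₀, ∀ x₁ ∈ Ω₁,
    ∀ t₀ ∈ transformedRange p, ∀ t₁ ∈ transformedRange p,
    ∀ A₀ A₁ : Matrix (Fin n) (Fin n) ℝ, A₀.IsSymm → A₁.IsSymm →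
      min (transformedOp F₀ p θ x₀ t₀ A₀) (transformedOp F₁ p θ x₁ t₁ A₁) ≤
        transformedOp Fμ p θ ((1 - μ) • x₀ + μ • x₁) ((1 - μ) * t₀ + μ * t₁)
          ((1 - μ) • A₀ + μ • A₁)

/-- `ν` is an inward direction of the open convex set `Ω` at the boundary point `x`: the open
half-line from `x` in direction `ν` meets `Ω`, i.e. (by convexity) starts inside `Ω`. -/
def IsInwardDirection {n : ℕ} (Ω : Set (EucSpace n)) (x ν : EucSpace n) : Prop :=
  ∃ t : ℝ, 0 < t ∧ x + t • ν ∈ Ω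

/-- `liminf_{y → x} ∂u(y)/∂ν > 0`, `y ∈ Ω`, at every boundary point `x` and for every inward
direction `ν` at `x`. The lower limit is taken in the extended reals. -/
def InwardDerivLiminfPos {n : ℕ} (Ω : Set (EucSpace n)) (u : EucSpace n → ℝ) : Prop :=
  ∀ x ∈ frontier Ω, ∀ ν : EucSpace n, IsInwardDirection Ω x ν →
    (0 : EReal) < liminf (fun y => ((fderiv ℝ u y ν : ℝ) : EReal)) (𝓝[Ω] x)

/-- The exponent `q = pr / (np + r)` for finite `r`, and `q = p` for `r = ∞`. -/
def normMeanExponent (n : ℕ) (p : ℝ) (r : ℝ≥0∞) : ℝ :=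
  if r = ∞ then p else p * r.toReal / (n * p + r.toReal)

end

/-! ### Algebra of weighted power means with exponent `p ≥ 0` -/

section PowMean

variable {p a b c d μ : ℝ}

/-! Let `w(x)` be the supremum of the `p`-means of `u₀(x₀)` and `u₁(x₁)` over all pairs in the
closures with `(1 - μ)x₀ + μx₁ = x` (`supConv`). The core is that `w` is a viscosity subsolution of
`Fμ = 0` vanishing on the boundary. Comparison then gives `w ≤ uμ` (`powMean_le_solution`), a
pointwise bound for the mean of two values, and the Borell–Brascamp–Lieb inequality
(`powMean_integral_le`), applied to `r`-th powers, integrates it. For `r = ∞` the bound is evaluated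
at maximum points.

Over an interior point the supremum is attained at a pair of interior points (`mem_of_eq_supConv`).
For `p = 0` a boundary value would annihilate the product. For `0 < p < 1` at least linear growth of
`u` at the boundary makes `u ^ p` grow at least like `t ^ p`, which beats the loss of order `t` at
the other point.

If `φ` touches `w` from above, then `φ((1 - μ)z₀ + μz₁)` dominates the mean of `u₀(z₀)` and `u₁(z₁)`
near the optimal pair, with equality there. The first order condition makes all vectors `u ^ (p - 1)
∇u` equal to one `θ`. The second order condition, with the points moved at speeds proportional to
`uᵢ ^ p`, bounds `D²φ` below by `φ ^ (1 - 3p)` times the combination of the matrices `uᵢ ^ (3p - 1)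
D²uᵢ`. These are exactly the scalings in `transformedOp`, so the structural assumption and
ellipticity yield the subsolution inequality (`AssumptionA.nonneg_of_touching`). -/

theorem powMean_zero : powMean 0 a b μ = a ^ (1 - μ) * b ^ μ := by simp [powMean]

theorem powMean_of_pos (hp : 0 < p) :
    powMean p a b μ = ((1 - μ) * a ^ p + μ * b ^ p) ^ (1 / p) := by
  simp [powMean, hp.ne', hp.not_gt]

theorem powMean_nonneg (hμ : μ ∈ Ioo (0 : ℝ) 1) (hp : 0 ≤ p) (ha : 0 ≤ a) (hb : 0 ≤ b) :
    0 ≤ powMean p a b μ := by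
  have h1 : 0 < 1 - μ := by linarith [hμ.2]
  have h2 := hμ.1
  rcases hp.eq_or_lt with rfl | hp
  · rw [powMean_zero]; positivity
  · rw [powMean_of_pos hp]; positivity

theorem powMean_pos (hμ : μ ∈ Ioo (0 : ℝ) 1) (hp : 0 ≤ p) (ha : 0 < a) (hb : 0 < b) :
    0 < powMean p a b μ := by
  have h1 : 0 < 1 - μ := by linarith [hμ.2]
  have h2 := hμ.1
  rcases hp.eq_or_lt with rfl | hp
  · rw [powMean_zero]; positivity
  · rw [powMean_of_pos hp]; positivity

theorem powMean_mono (hμ : μ ∈ Ioo (0 : ℝ) 1) (hp : 0 ≤ p) (ha : 0 ≤ a) (hb : 0 ≤ b)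
    (hac : a ≤ c) (hbd : b ≤ d) : powMean p a b μ ≤ powMean p c d μ := by
  have h1 : 0 < 1 - μ := by linarith [hμ.2]
  have h2 := hμ.1
  have hc := ha.trans hac
  rcases hp.eq_or_lt with rfl | hp
  · rw [powMean_zero, powMean_zero]; gcongr
  · rw [powMean_of_pos hp, powMean_of_pos hp]; gcongr

theorem powMean_mul_left (hμ : μ ∈ Ioo (0 : ℝ) 1) (hp : 0 ≤ p) (hc : 0 ≤ c) (ha : 0 ≤ a)
    (hb : 0 ≤ b) : powMean p (c * a) (c * b) μ = c * powMean p a b μ := by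
  have h1 : 0 < 1 - μ := by linarith [hμ.2]
  have h2 := hμ.1
  rcases hp.eq_or_lt with rfl | hp
  · rw [powMean_zero, powMean_zero, Real.mul_rpow hc ha, Real.mul_rpow hc hb]
    have : c ^ (1 - μ) * c ^ μ = c := by
      rw [← Real.rpow_add' hc (by norm_num)]; simp
    linear_combination (a ^ (1 - μ) * b ^ μ) * this
  · rw [powMean_of_pos hp, powMean_of_pos hp, Real.mul_rpow hc ha, Real.mul_rpow hc hb]
    have : (1 - μ) * (c ^ p * a ^ p) + μ * (c ^ p * b ^ p)
      = c ^ p * ((1 - μ) * a ^ p + μ * b ^ p) := by ring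
    rw [this, Real.mul_rpow (by positivity) (by positivity), ← Real.rpow_mul hc,
      mul_one_div_cancel hp.ne', Real.rpow_one]

theorem powMean_zero_zero (hμ : μ ∈ Ioo (0 : ℝ) 1) (hp : 0 ≤ p) : powMean p 0 0 μ = 0 := by
  simpa using powMean_mul_left (c := 0) (a := 0) (b := 0) hμ hp le_rfl le_rfl le_rfl

theorem powMean_rpow (hμ : μ ∈ Ioo (0 : ℝ) 1) (hp : 0 ≤ p) {r : ℝ} (hr : 0 < r) (ha : 0 ≤ a)
    (hb : 0 ≤ b) : powMean p a b μ ^ r = powMean (p / r) (a ^ r) (b ^ r) μ := by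
  have h1 : 0 < 1 - μ := by linarith [hμ.2]
  have h2 := hμ.1
  rcases hp.eq_or_lt with rfl | hp
  · rw [zero_div, powMean_zero, powMean_zero, Real.mul_rpow (by positivity) (by positivity)]
    simp only [← Real.rpow_mul ha, ← Real.rpow_mul hb, mul_comm r]
  · have h : r * (p / r) = p := by field_simp
    rw [powMean_of_pos hp, powMean_of_pos (by positivity), ← Real.rpow_mul ha, ← Real.rpow_mul hb,
      ← Real.rpow_mul (by positivity), h]
    congr 1
    field_simp

/-- Hölder's inequality for means. -/
theorem powMean_mul_le (hμ : μ ∈ Ioo (0 : ℝ) 1) (hp : 0 ≤ p) (ha : 0 < a) (hb : 0 < b)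
    (hc : 0 < c) (hd : 0 < d) :
    powMean (p / (1 + p)) (a * c) (b * d) μ ≤ powMean p a b μ * ((1 - μ) * c + μ * d) := by
  have h1 : 0 < 1 - μ := by linarith [hμ.2]
  have h2 := hμ.1
  rcases hp.eq_or_lt with rfl | hp
  · rw [zero_div, powMean_zero, powMean_zero, Real.mul_rpow ha.le hc.le, Real.mul_rpow hb.le hd.le]
    have := Real.geom_mean_le_arith_mean2_weighted h1.le h2.le hc.le hd.le (by ring)
    calc _ = (a ^ (1 - μ) * b ^ μ) * (c ^ (1 - μ) * d ^ μ) := by ring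
      _ ≤ _ := by gcongr
  · have hq : 0 < p / (1 + p) := by positivity
    rw [powMean_of_pos hp, powMean_of_pos hq]
    set X := (1 - μ) * a ^ p + μ * b ^ p with hX
    set Y := (1 - μ) * c + μ * d with hY
    have hX0 : 0 < X := by positivity
    have hY0 : 0 < Y := by positivity
    -- Weighted AM–GM with exponents `1/(1+p)` and `p/(1+p)`. Dividing by `X` and `Y` first makes
    -- the averaged bracket equal to `1`.
    have key : ∀ x y : ℝ, 0 < x → 0 < y → (x * y) ^ (p / (1 + p)) ≤
        X ^ (1 / (1 + p)) * Y ^ (p / (1 + p)) *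
          (1 / (1 + p) * (x ^ p / X) + p / (1 + p) * (y / Y)) := by
      intro x y hx hy
      have := Real.geom_mean_le_arith_mean2_weighted (w₁ := 1 / (1 + p)) (w₂ := p / (1 + p))
        (p₁ := x ^ p / X) (p₂ := y / Y) (by positivity) (by positivity) (by positivity)
        (by positivity) (by field_simp)
      calc (x * y) ^ (p / (1 + p))
          = X ^ (1 / (1 + p)) * Y ^ (p / (1 + p)) *
            ((x ^ p / X) ^ (1 / (1 + p)) * (y / Y) ^ (p / (1 + p))) := by
            rw [Real.div_rpow (by positivity) hX0.le, Real.div_rpow hy.le hY0.le,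
              Real.mul_rpow hx.le hy.le, ← Real.rpow_mul hx.le]
            have : p * (1 / (1 + p)) = p / (1 + p) := by ring
            rw [this]
            field_simp
        _ ≤ _ := by gcongr
    have hsum : (1 - μ) * (a * c) ^ (p / (1 + p)) + μ * (b * d) ^ (p / (1 + p)) ≤
        X ^ (1 / (1 + p)) * Y ^ (p / (1 + p)) := by
      calc _ ≤ (1 - μ) * (X ^ (1 / (1 + p)) * Y ^ (p / (1 + p)) *
            (1 / (1 + p) * (a ^ p / X) + p / (1 + p) * (c / Y))) +
            μ * (X ^ (1 / (1 + p)) * Y ^ (p / (1 + p)) *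
            (1 / (1 + p) * (b ^ p / X) + p / (1 + p) * (d / Y))) := by
            gcongr
            · exact key a c ha hc
            · exact key b d hb hd
        _ = X ^ (1 / (1 + p)) * Y ^ (p / (1 + p)) *
            (1 / (1 + p) * (((1 - μ) * a ^ p + μ * b ^ p) / X) +
              p / (1 + p) * (((1 - μ) * c + μ * d) / Y)) := by ring
        _ = _ := by
          rw [← hX, ← hY, div_self hX0.ne', div_self hY0.ne']
          field_simp
    calc _ ≤ (X ^ (1 / (1 + p)) * Y ^ (p / (1 + p))) ^ (1 / (p / (1 + p))) := by gcongr
      _ = _ := by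
        rw [Real.mul_rpow (by positivity) (by positivity), ← Real.rpow_mul hX0.le,
          ← Real.rpow_mul hY0.le, mul_one_div_cancel hq.ne', Real.rpow_one]
        congr 2
        field_simp

theorem continuousOn_powMean (hμ : μ ∈ Ioo (0 : ℝ) 1) (hp : 0 ≤ p) :
    ContinuousOn (fun z : ℝ × ℝ => powMean p z.1 z.2 μ) (Ici 0 ×ˢ Ici 0) := by
  have h1 : 0 < 1 - μ := by linarith [hμ.2]
  have h2 := hμ.1
  rcases hp.eq_or_lt with rfl | hp
  · simp only [powMean_zero]
    exact ((continuous_fst.rpow_const fun _ => .inr h1.le).mul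
      (continuous_snd.rpow_const fun _ => .inr h2.le)).continuousOn
  · simp only [powMean_of_pos hp]
    refine Continuous.continuousOn ?_
    refine Continuous.rpow_const ?_ fun _ => .inr (by positivity)
    exact (continuous_const.mul (continuous_fst.rpow_const fun _ => .inr hp.le)).add
      (continuous_const.mul (continuous_snd.rpow_const fun _ => .inr hp.le))

end PowMean

/-! ### Borell–Brascamp–Lieb inequality -/

section BorellBrascampLieb

/-- The one-dimensional Brunn–Minkowski inequality. -/
theorem volume_add_volume_le_volume_add {A B : Set ℝ} (hA : MeasurableSet A) (hB : MeasurableSet B)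
    (hA' : A.Nonempty) (hB' : B.Nonempty) : volume A + volume B ≤ volume (A + B) := by
  have key : ∀ K ⊆ A, IsCompact K → ∀ L ⊆ B, IsCompact L →
      volume K + volume L ≤ volume (A + B) := by
    intro K hK hKc L hL hLc
    obtain ⟨a, ha⟩ := hA'
    obtain ⟨b, hb⟩ := hB'
    -- Inserting `a` and `b` provides extreme points even when `K` or `L` is empty.
    obtain ⟨k, hk, hk'⟩ := (hKc.insert a).exists_isGreatest (insert_nonempty _ _)
    obtain ⟨l, hl, hl'⟩ := (hLc.insert b).exists_isLeast (insert_nonempty _ _)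
    have hkA : k ∈ A := insert_subset ha hK hk
    have hlB : l ∈ B := insert_subset hb hL hl
    -- The translate `l + K` lies to the left of `k + l` and `k + L` to the right, so they overlap
    -- in at most one point, and both lie in `A + B`.
    have h1 : volume ((l + ·) '' K) = volume K := by simp
    have h2 : volume ((k + ·) '' L) = volume L := by simp
    rw [← h1, ← h2, ← measure_union₀]
    · refine measure_mono (union_subset ?_ ?_)
      · rintro _ ⟨x, hx, rfl⟩
        exact ⟨x, hK hx, l, hlB, add_comm _ _⟩
      · rintro _ ⟨x, hx, rfl⟩
        exact ⟨k, hkA, x, hL hx, rfl⟩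
    · exact (hLc.image (continuous_const_add k)).measurableSet.nullMeasurableSet
    · refine measure_mono_null (t := {k + l}) ?_ (by simp)
      rintro z ⟨⟨x, hx, rfl⟩, ⟨y, hy, hxy⟩⟩
      have h3 := hk' (mem_insert_of_mem _ hx)
      have h4 := hl' (mem_insert_of_mem _ hy)
      simp only [mem_singleton_iff] at hxy ⊢
      linarith
  rw [hA.measure_eq_iSup_isCompact, hB.measure_eq_iSup_isCompact]
  have hE : ∀ S : Set ℝ, (⨆ K, ⨆ (_ : K ⊆ S), ⨆ (_ : IsCompact K), volume K) =
      ⨆ K, ⨆ (_ : K ⊆ S ∧ IsCompact K), volume K := fun S => by simp only [iSup_and]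
  rw [hE, hE]
  exact ENNReal.biSup_add_biSup_le' ⟨∅, empty_subset _, isCompact_empty⟩
    ⟨∅, empty_subset _, isCompact_empty⟩ fun K hK L hL => key K hK.1 hK.2 L hL.1 hL.2

/-- Bounded nonnegative measurable functions with bounded support. -/
structure IsBoundedDensity {E : Type*} [NormedAddCommGroup E] [MeasurableSpace E] (f : E → ℝ) :
    Prop where
  measurable : Measurable f
  nonneg : ∀ x, 0 ≤ f x
  bound : ∃ C, ∀ x, f x ≤ C
  support : ∃ R, ∀ x, f x ≠ 0 → ‖x‖ ≤ R

theorem IsBoundedDensity.integrable {E : Type*} [NormedAddCommGroup E] [ProperSpace E]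
    [MeasureSpace E] [OpensMeasurableSpace E] [IsFiniteMeasureOnCompacts (volume : Measure E)]
    {f : E → ℝ} (hf : IsBoundedDensity f) : Integrable f := by
  obtain ⟨C, hC⟩ := hf.bound
  obtain ⟨R, hR⟩ := hf.support
  have hs : Function.support f ⊆ Metric.closedBall 0 R := fun x hx => by
    simpa using hR x hx
  rw [← integrableOn_iff_integrable_of_support_subset hs]
  refine Measure.integrableOn_of_bounded (M := C)
    (isCompact_closedBall _ _).measure_lt_top.ne hf.measurable.aestronglyMeasurable ?_
  refine ae_of_all _ fun x => ?_
  rw [Real.norm_of_nonneg (hf.nonneg x)]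
  exact hC x

variable {p μ : ℝ}

/-- Normalising `f` and `g` by their suprema makes their superlevel sets nonempty for exactly the
same levels, so Brunn–Minkowski applies level by level. The layer-cake formula integrates the
result, and `powMean_mul_le` removes the normalisation. -/
theorem powMean_integral_le_real (hμ : μ ∈ Ioo (0 : ℝ) 1) (hp : 0 ≤ p) {f g h : ℝ → ℝ}
    (hf : IsBoundedDensity f) (hg : IsBoundedDensity g) (hh : IsBoundedDensity h)
    (H : ∀ x y, 0 < f x → 0 < g y → powMean p (f x) (g y) μ ≤ h ((1 - μ) * x + μ * y))
    (hf0 : 0 < ∫ x, f x) (hg0 : 0 < ∫ x, g x) :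
    powMean (p / (1 + p)) (∫ x, f x) (∫ x, g x) μ ≤ ∫ x, h x := by
  have h1 : 0 < 1 - μ := by linarith [hμ.2]
  have h2 := hμ.1
  have sup : ∀ {f : ℝ → ℝ}, IsBoundedDensity f → 0 < ∫ x, f x →
      ∃ a, 0 < a ∧ (∀ x, f x ≤ a) ∧ ∀ t < a, ∃ x, t < f x := by
    intro f hf hf0
    have hb : BddAbove (range f) := by
      obtain ⟨C, hC⟩ := hf.bound
      exact ⟨C, by rintro _ ⟨x, rfl⟩; exact hC x⟩
    refine ⟨⨆ x, f x, ?_, fun x => le_ciSup hb x, fun t ht => exists_lt_of_lt_ciSup ht⟩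
    by_contra hcon
    refine hf0.not_ge (integral_nonpos fun x => (le_ciSup hb x).trans (not_lt.1 hcon))
  obtain ⟨a, ha, hfa, hfa'⟩ := sup hf hf0
  obtain ⟨b, hb, hgb, hgb'⟩ := sup hg hg0
  set M := powMean p a b μ with hM
  have hM0 : 0 < M := powMean_pos hμ hp ha hb
  have level : ∀ t, 0 < t → ENNReal.ofReal (1 - μ) * volume {x | t < f x / a} +
      ENNReal.ofReal μ * volume {x | t < g x / b} ≤ volume {x | t < h x / M} := by
    intro t ht
    rcases lt_or_ge t 1 with ht1 | ht1
    · have hA : ((1 - μ) • {x | t < f x / a}).Nonempty := by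
        obtain ⟨x, hx⟩ := hfa' (t * a) (by nlinarith)
        exact ⟨_, x, (lt_div_iff₀ ha).2 hx, rfl⟩
      have hB : (μ • {x | t < g x / b}).Nonempty := by
        obtain ⟨x, hx⟩ := hgb' (t * b) (by nlinarith)
        exact ⟨_, x, (lt_div_iff₀ hb).2 hx, rfl⟩
      have hmf : MeasurableSet {x | t < f x / a} :=
        measurableSet_lt measurable_const (hf.measurable.div_const a)
      have hmg : MeasurableSet {x | t < g x / b} :=
        measurableSet_lt measurable_const (hg.measurable.div_const b)
      have := volume_add_volume_le_volume_add (hmf.const_smul₀ (1 - μ)) (hmg.const_smul₀ μ) hA hB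
      rw [Measure.addHaar_smul, Measure.addHaar_smul] at this
      simp only [Module.finrank_self, pow_one, abs_of_pos h1, abs_of_pos h2] at this
      refine this.trans (measure_mono ?_)
      rintro _ ⟨_, ⟨x, hx, rfl⟩, _, ⟨y, hy, rfl⟩, rfl⟩
      simp only [mem_ofPred_eq, smul_eq_mul] at hx hy ⊢
      rw [lt_div_iff₀ hM0]
      rw [lt_div_iff₀ ha] at hx
      rw [lt_div_iff₀ hb] at hy
      have hx0 : 0 < f x := lt_trans (by positivity) hx
      have hy0 : 0 < g y := lt_trans (by positivity) hy
      refine lt_of_lt_of_le ?_ (H x y hx0 hy0)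
      -- Passing to the common level `m` allows the homogeneity of the mean to be used.
      set m := min (f x / a) (g y / b) with hm
      have htm : t < m := lt_min ((lt_div_iff₀ ha).2 hx) ((lt_div_iff₀ hb).2 hy)
      have hm0 : 0 < m := ht.trans htm
      calc t * M < m * M := by gcongr
        _ = powMean p (m * a) (m * b) μ := (powMean_mul_left hμ hp hm0.le ha.le hb.le).symm
        _ ≤ _ := powMean_mono hμ hp (by positivity) (by positivity)
          ((le_div_iff₀ ha).1 (min_le_left _ _)) ((le_div_iff₀ hb).1 (min_le_right _ _))
    · have e1 : {x | t < f x / a} = ∅ := by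
        ext x
        simpa using ((div_le_one ha).2 (hfa x)).trans ht1
      have e2 : {x | t < g x / b} = ∅ := by
        ext x
        simpa using ((div_le_one hb).2 (hgb x)).trans ht1
      simp [e1, e2]
  have cake : ∀ {f : ℝ → ℝ}, IsBoundedDensity f → ∀ {a : ℝ}, 0 < a →
      ENNReal.ofReal ((∫ x, f x) / a) = ∫⁻ t in Ioi 0, volume {x | t < f x / a} := by
    intro f hf a ha
    rw [← integral_div, ofReal_integral_eq_lintegral_ofReal (hf.integrable.div_const a)
      (ae_of_all _ fun x => div_nonneg (hf.nonneg x) ha.le)]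
    exact lintegral_eq_lintegral_meas_lt _ (ae_of_all _ fun x => div_nonneg (hf.nonneg x) ha.le)
      (hf.measurable.div_const a).aemeasurable
  have meas : ∀ f : ℝ → ℝ, Measurable fun t : ℝ => volume {x | t < f x} := fun f =>
    Antitone.measurable fun s t hst => measure_mono fun x hx => lt_of_le_of_lt hst hx
  have hI : (1 - μ) * ((∫ x, f x) / a) + μ * ((∫ x, g x) / b) ≤ (∫ x, h x) / M := by
    rw [← ENNReal.ofReal_le_ofReal_iff (div_nonneg (integral_nonneg hh.nonneg) hM0.le),
      ENNReal.ofReal_add (by positivity) (by positivity), ENNReal.ofReal_mul h1.le,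
      ENNReal.ofReal_mul h2.le, cake hf ha, cake hg hb, cake hh hM0,
      ← lintegral_const_mul _ (meas _), ← lintegral_const_mul _ (meas _),
      ← lintegral_add_left ((meas _).const_mul _)]
    exact setLIntegral_mono' measurableSet_Ioi fun t ht => level t ht
  have := powMean_mul_le hμ hp ha hb (div_pos hf0 ha) (div_pos hg0 hb)
  rw [mul_div_cancel₀ _ ha.ne', mul_div_cancel₀ _ hb.ne'] at this
  refine this.trans ?_
  rw [le_div_iff₀ hM0] at hI
  linarith

theorem IsBoundedDensity.comp_cons {n : ℕ} {f : (Fin (n + 1) → ℝ) → ℝ} (hf : IsBoundedDensity f)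
    (t : ℝ) : IsBoundedDensity fun x : Fin n → ℝ => f (Fin.cons t x) where
  measurable := hf.measurable.comp <| measurable_pi_lambda _ fun i => by
    refine Fin.cases ?_ (fun i => ?_) i
    · simp
    · simpa using measurable_pi_apply i
  nonneg x := hf.nonneg _
  bound := hf.bound.imp fun C hC x => hC _
  support := by
    obtain ⟨R, hR⟩ := hf.support
    refine ⟨max R 0, fun x hx => ?_⟩
    rw [pi_norm_le_iff_of_nonneg (le_max_right _ _)]
    intro i
    have := (norm_le_pi_norm (Fin.cons t x : Fin (n + 1) → ℝ) i.succ).trans (hR _ hx)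
    exact le_max_of_le_left (by simpa using this)

theorem IsBoundedDensity.marginal {n : ℕ} {f : (Fin (n + 1) → ℝ) → ℝ} (hf : IsBoundedDensity f) :
    IsBoundedDensity fun t : ℝ => ∫ x : Fin n → ℝ, f (Fin.cons t x) := by
  obtain ⟨C, hC⟩ := hf.bound
  obtain ⟨R, hR⟩ := hf.support
  have hcons : ∀ (t : ℝ) (x : Fin n → ℝ), f (Fin.cons t x) ≠ 0 → ‖t‖ ≤ R ∧ ‖x‖ ≤ R := by
    intro t x hx
    have h0 := (norm_le_pi_norm (Fin.cons t x : Fin (n + 1) → ℝ) 0).trans (hR _ hx)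
    have h1 : 0 ≤ R := (norm_nonneg _).trans h0
    refine ⟨by simpa using h0, ?_⟩
    rw [pi_norm_le_iff_of_nonneg h1]
    intro i
    simpa using (norm_le_pi_norm (Fin.cons t x : Fin (n + 1) → ℝ) i.succ).trans (hR _ hx)
  refine ⟨?_, fun t => integral_nonneg fun x => hf.nonneg _, ?_, R, fun t ht => ?_⟩
  · have hm : Measurable fun z : ℝ × (Fin n → ℝ) => f (Fin.cons z.1 z.2) :=
      hf.measurable.comp <| measurable_pi_lambda _ fun i => by
        refine Fin.cases ?_ (fun i => ?_) i
        · simpa using measurable_fst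
        · simpa [Function.comp_def] using (measurable_pi_apply i).comp measurable_snd
    exact (hm.stronglyMeasurable.integral_prod_right (ν := volume)).measurable
  · refine ⟨∫ x : Fin n → ℝ in Metric.closedBall 0 R, C, fun t => ?_⟩
    have hs : Function.support (fun x : Fin n → ℝ => f (Fin.cons t x)) ⊆
        Metric.closedBall 0 R := fun x hx => by simpa using (hcons t x hx).2
    rw [← setIntegral_eq_integral_of_forall_compl_eq_zero (s := Metric.closedBall 0 R)
      (fun x hx => by_contra fun h => hx (hs h))]
    refine setIntegral_mono_on (hf.comp_cons t).integrable.integrableOn ?_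
      Metric.isClosed_closedBall.measurableSet fun x _ => hC _
    exact integrableOn_const (isCompact_closedBall _ _).measure_lt_top.ne
  · by_contra hcon
    refine ht ?_
    have : ∀ x : Fin n → ℝ, f (Fin.cons t x) = 0 := fun x => by
      by_contra h
      exact hcon (hcons t x h).1
    simp [this]

theorem IsBoundedDensity.integral_marginal {n : ℕ} {f : (Fin (n + 1) → ℝ) → ℝ}
    (hf : IsBoundedDensity f) : ∫ t : ℝ, ∫ x : Fin n → ℝ, f (Fin.cons t x) = ∫ x, f x := by
  have e := (volume_preserving_piFinSuccAbove (fun _ : Fin (n + 1) => ℝ) 0).symm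
  have hc : ∀ z : ℝ × (Fin n → ℝ),
      (MeasurableEquiv.piFinSuccAbove (fun _ : Fin (n + 1) => ℝ) 0).symm z =
        Fin.cons z.1 z.2 := fun z => by
    ext i
    simp [MeasurableEquiv.piFinSuccAbove]
  have h1 := e.integral_comp (MeasurableEquiv.measurableEmbedding _) f
  have h2 := (e.integrable_comp_emb (MeasurableEquiv.measurableEmbedding _)).2 hf.integrable
  rw [← h1]
  simp only [Function.comp_def, hc] at h2 ⊢
  exact (integral_prod _ h2).symm

/-- The **Borell–Brascamp–Lieb inequality** for nonnegative exponents. -/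
theorem powMean_integral_le_pi (hμ : μ ∈ Ioo (0 : ℝ) 1) (hp : 0 ≤ p) {n : ℕ}
    {f g h : (Fin n → ℝ) → ℝ}
    (hf : IsBoundedDensity f) (hg : IsBoundedDensity g) (hh : IsBoundedDensity h)
    (H : ∀ x y, 0 < f x → 0 < g y → powMean p (f x) (g y) μ ≤ h ((1 - μ) • x + μ • y))
    (hf0 : 0 < ∫ x, f x) (hg0 : 0 < ∫ x, g x) :
    powMean (p / (n * p + 1)) (∫ x, f x) (∫ x, g x) μ ≤ ∫ x, h x := by
  induction n with
  | zero =>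
    have e : ∀ f : (Fin 0 → ℝ) → ℝ, ∫ x, f x = f default := fun f => by
      rw [volume_pi, Measure.pi_of_empty (x := default)]; simp
    simp only [e, CharP.cast_eq_zero, zero_mul, zero_add, div_one] at hf0 hg0 ⊢
    convert H _ _ hf0 hg0 using 2
  | succ n ih =>
    rw [← hf.integral_marginal, ← hg.integral_marginal, ← hh.integral_marginal]
    rw [← hf.integral_marginal] at hf0
    rw [← hg.integral_marginal] at hg0
    -- By induction on slices the marginals satisfy the one-dimensional hypothesis with exponent
    -- `p/(np+1)`; the map `q ↦ q/(1+q)` sends this to `p/((n+1)p+1)`.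
    have := powMean_integral_le_real (p := p / (n * p + 1)) hμ (by positivity) hf.marginal
      hg.marginal hh.marginal (fun s t hs ht => ?_) hf0 hg0
    · convert this using 2
      push_cast
      field_simp
      ring
    · refine ih (hf.comp_cons s) (hg.comp_cons t) (hh.comp_cons _) (fun x y hx hy => ?_) hs ht
      convert H _ _ hx hy using 2
      ext i
      refine Fin.cases ?_ (fun i => ?_) i <;> simp

theorem powMean_integral_le (hμ : μ ∈ Ioo (0 : ℝ) 1) (hp : 0 ≤ p) {n : ℕ}
    {f g h : EucSpace n → ℝ}
    (hf : IsBoundedDensity f) (hg : IsBoundedDensity g) (hh : IsBoundedDensity h)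
    (H : ∀ x y, 0 < f x → 0 < g y → powMean p (f x) (g y) μ ≤ h ((1 - μ) • x + μ • y))
    (hf0 : 0 < ∫ x, f x) (hg0 : 0 < ∫ x, g x) :
    powMean (p / (n * p + 1)) (∫ x, f x) (∫ x, g x) μ ≤ ∫ x, h x := by
  have e : ∀ f : EucSpace n → ℝ, ∫ x : Fin n → ℝ, f (WithLp.toLp 2 x) = ∫ x, f x := fun f =>
    (PiLp.volume_preserving_toLp (Fin n)).integral_comp
      (MeasurableEquiv.toLp 2 (Fin n → ℝ)).measurableEmbedding f
  have d : ∀ {f : EucSpace n → ℝ}, IsBoundedDensity f →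
      IsBoundedDensity fun x : Fin n → ℝ => f (WithLp.toLp 2 x) := fun {f} hf => by
    refine ⟨hf.measurable.comp (MeasurableEquiv.toLp 2 (Fin n → ℝ)).measurable,
      fun x => hf.nonneg _, hf.bound.imp fun C hC x => hC _, ?_⟩
    obtain ⟨R, hR⟩ := hf.support
    refine ⟨R, fun x hx => ?_⟩
    have h1 := hR _ hx
    rw [pi_norm_le_iff_of_nonneg ((norm_nonneg _).trans h1)]
    intro i
    exact (PiLp.norm_apply_le (WithLp.toLp 2 x) i).trans h1
  rw [← e f, ← e g, ← e h]
  rw [← e f] at hf0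
  rw [← e g] at hg0
  refine powMean_integral_le_pi hμ hp (d hf) (d hg) (d hh) (fun x y hx hy => ?_) hf0 hg0
  simpa using H _ _ hx hy

end BorellBrascampLieb

/-! ### First and second order conditions at a touching point -/

section SecondOrder

/-- If `c < 0`, the second derivative test makes `x` a local maximum too. Then `f` is locally
constant and `c = 0`, a contradiction. -/
theorem IsLocalMin.second_deriv_nonneg {f f' : ℝ → ℝ} {x c : ℝ} (hmin : IsLocalMin f x)
    (h1 : ∀ᶠ s in 𝓝 x, HasDerivAt f (f' s) s) (h2 : HasDerivAt f' c x) : 0 ≤ c := by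
  by_contra! hc
  have hd : deriv f =ᶠ[𝓝 x] f' := h1.mono fun s hs => hs.deriv
  have hmax : IsLocalMax f x := by
    refine isLocalMax_of_deriv_deriv_neg ?_ hmin.deriv_eq_zero h1.self_of_nhds.continuousAt
    rwa [hd.deriv_eq, h2.deriv]
  have hconst : f =ᶠ[𝓝 x] fun _ => f x := by
    filter_upwards [hmin, hmax] with y h3 h4 using le_antisymm h4 h3
  have hz : f' =ᶠ[𝓝 x] fun _ => 0 := by
    filter_upwards [hd, hconst.eventuallyEq_nhds] with y h3 h4
    rw [← h3, h4.deriv_eq, deriv_const]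
  have := h2.congr_of_eventuallyEq hz.symm
  exact hc.ne (this.unique (hasDerivAt_const x (0 : ℝ)))

section Line

variable {E : Type*} [NormedAddCommGroup E] [NormedSpace ℝ E] {u : E → ℝ} {x : E}

theorem hasDerivAt_line (x e : E) (s : ℝ) : HasDerivAt (fun s : ℝ => x + s • e) e s := by
  simpa using ((hasDerivAt_id s).smul_const e).const_add x

theorem ContDiffAt.eventually_hasDerivAt_line (hu : ContDiffAt ℝ 2 u x) (e : E) :
    ∀ᶠ s : ℝ in 𝓝 0, HasDerivAt (fun s : ℝ => u (x + s • e)) (fderiv ℝ u (x + s • e) e) s := by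
  have hc : Tendsto (fun s : ℝ => x + s • e) (𝓝 0) (𝓝 x) := by
    simpa using (hasDerivAt_line x e 0).continuousAt.tendsto
  filter_upwards [hc.eventually (hu.eventually (by simp))] with s hs
  exact (hs.differentiableAt (by simp)).hasFDerivAt.comp_hasDerivAt s (hasDerivAt_line x e s)

theorem ContDiffAt.hasDerivAt_fderiv_line (hu : ContDiffAt ℝ 2 u x) (e : E) :
    HasDerivAt (fun s : ℝ => fderiv ℝ u (x + s • e) e) (fderiv ℝ (fderiv ℝ u) x e e) 0 := by
  have h1 : DifferentiableAt ℝ (fderiv ℝ u) (x + (0 : ℝ) • e) := by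
    simpa using (hu.fderiv_right (m := 1) (by norm_num)).differentiableAt (by simp)
  have h2 := h1.hasFDerivAt.comp_hasDerivAt (0 : ℝ) (hasDerivAt_line x e 0)
  simpa using h2.clm_apply (hasDerivAt_const (0 : ℝ) e)

end Line

/-- The primitive of `t ↦ t ^ (p - 1)` on the positive half-line, for `p ≥ 0`. -/
noncomputable def powPrim (p t : ℝ) : ℝ := if p = 0 then Real.log t else t ^ p / p

variable {p μ : ℝ}

theorem hasDerivAt_powPrim {t : ℝ} (ht : 0 < t) :
    HasDerivAt (powPrim p) (t ^ (p - 1)) t := by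
  by_cases hp : p = 0
  · subst hp
    have : powPrim 0 = Real.log := by ext; simp [powPrim]
    rw [this, zero_sub, Real.rpow_neg_one]
    exact Real.hasDerivAt_log ht.ne'
  · have : powPrim p = fun t => t ^ p / p := by ext; simp [powPrim, hp]
    rw [this]
    have h := (Real.hasDerivAt_rpow_const (p := p) (.inl ht.ne')).div_const p
    rwa [mul_div_cancel_left₀ _ hp] at h

theorem powPrim_le_powPrim (hp : 0 ≤ p) {s t : ℝ} (hs : 0 < s) (hst : s ≤ t) :
    powPrim p s ≤ powPrim p t := by
  rcases hp.eq_or_lt with rfl | hp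
  · simpa [powPrim] using Real.log_le_log hs hst
  · simp only [powPrim, hp.ne', if_false]
    gcongr

theorem powMean_rpow_self (hμ : μ ∈ Ioo (0 : ℝ) 1) (hp : 0 ≤ p) {a b : ℝ} (ha : 0 < a)
    (hb : 0 < b) : powMean p a b μ ^ p = (1 - μ) * a ^ p + μ * b ^ p := by
  have h1 : 0 < 1 - μ := by linarith [hμ.2]
  have h2 := hμ.1
  rcases hp.eq_or_lt with rfl | hp
  · simp
  · rw [powMean_of_pos hp, ← Real.rpow_mul (by positivity), one_div_mul_cancel hp.ne',
      Real.rpow_one]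

theorem powPrim_powMean (hμ : μ ∈ Ioo (0 : ℝ) 1) (hp : 0 ≤ p) {a b : ℝ} (ha : 0 < a)
    (hb : 0 < b) : powPrim p (powMean p a b μ) = (1 - μ) * powPrim p a + μ * powPrim p b := by
  rcases hp.eq_or_lt with rfl | hp
  · simp only [powPrim, if_true, powMean_zero]
    rw [Real.log_mul (by positivity) (by positivity), Real.log_rpow ha, Real.log_rpow hb]
  · simp only [powPrim, hp.ne', if_false]
    rw [powMean_rpow_self hμ hp.le ha hb]
    ring

section Compose

variable {f f' : ℝ → ℝ} {x c : ℝ}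

theorem eventually_hasDerivAt_powPrim_comp (hx : 0 < f x)
    (h1 : ∀ᶠ s in 𝓝 x, HasDerivAt f (f' s) s) :
    ∀ᶠ s in 𝓝 x, HasDerivAt (fun s => powPrim p (f s)) (f s ^ (p - 1) * f' s) s := by
  have hc := h1.self_of_nhds.continuousAt.eventually (lt_mem_nhds hx)
  filter_upwards [h1, hc] with s h3 h4
  exact (hasDerivAt_powPrim h4).comp s h3

theorem hasDerivAt_deriv_powPrim_comp (hx : 0 < f x)
    (h1 : HasDerivAt f (f' x) x) (h2 : HasDerivAt f' c x) :
    HasDerivAt (fun s => f s ^ (p - 1) * f' s)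
      ((p - 1) * f x ^ (p - 2) * f' x ^ 2 + f x ^ (p - 1) * c) x := by
  have := ((Real.hasDerivAt_rpow_const (p := p - 1) (.inl hx.ne')).comp x h1).mul h2
  have e : p - 1 - 1 = p - 2 := by ring
  rw [e] at this
  refine this.congr_deriv ?_
  simp only [Function.comp_apply]
  ring

end Compose

section Touching

variable {E : Type*} [NormedAddCommGroup E] [NormedSpace ℝ E] {u₀ u₁ φ : E → ℝ} {x₀ x₁ x : E}

/-- First and second order conditions where a smooth function touches from above, along lines, the
supremal convolution of two smooth positive functions. -/
theorem touching_line_conditions (hμ : μ ∈ Ioo (0 : ℝ) 1) (hp : 0 ≤ p)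
    (hu₀ : ContDiffAt ℝ 2 u₀ x₀) (hu₁ : ContDiffAt ℝ 2 u₁ x₁) (hφ : ContDiffAt ℝ 2 φ x)
    (h₀ : 0 < u₀ x₀) (h₁ : 0 < u₁ x₁) (hx : x = (1 - μ) • x₀ + μ • x₁)
    (heq : φ x = powMean p (u₀ x₀) (u₁ x₁) μ)
    (hle : ∀ᶠ z in 𝓝 (x₀, x₁), powMean p (u₀ z.1) (u₁ z.2) μ ≤ φ ((1 - μ) • z.1 + μ • z.2))
    {e₀ e₁ e : E} (he : e = (1 - μ) • e₀ + μ • e₁) :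
    φ x ^ (p - 1) * fderiv ℝ φ x e = (1 - μ) * (u₀ x₀ ^ (p - 1) * fderiv ℝ u₀ x₀ e₀) +
        μ * (u₁ x₁ ^ (p - 1) * fderiv ℝ u₁ x₁ e₁) ∧
      (1 - μ) * ((p - 1) * u₀ x₀ ^ (p - 2) * fderiv ℝ u₀ x₀ e₀ ^ 2 +
          u₀ x₀ ^ (p - 1) * fderiv ℝ (fderiv ℝ u₀) x₀ e₀ e₀) +
        μ * ((p - 1) * u₁ x₁ ^ (p - 2) * fderiv ℝ u₁ x₁ e₁ ^ 2 +
          u₁ x₁ ^ (p - 1) * fderiv ℝ (fderiv ℝ u₁) x₁ e₁ e₁) ≤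
      (p - 1) * φ x ^ (p - 2) * fderiv ℝ φ x e ^ 2 +
          φ x ^ (p - 1) * fderiv ℝ (fderiv ℝ φ) x e e := by
  have hm : 0 < φ x := heq ▸ powMean_pos hμ hp h₀ h₁
  have data : ∀ {u : E → ℝ} {y : E} (d : E), ContDiffAt ℝ 2 u y → 0 < u y →
      (∀ᶠ s : ℝ in 𝓝 0, HasDerivAt (fun s : ℝ => powPrim p (u (y + s • d)))
        (u (y + s • d) ^ (p - 1) * fderiv ℝ u (y + s • d) d) s) ∧
      HasDerivAt (fun s : ℝ => u (y + s • d) ^ (p - 1) * fderiv ℝ u (y + s • d) d)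
        ((p - 1) * u y ^ (p - 2) * fderiv ℝ u y d ^ 2 +
          u y ^ (p - 1) * fderiv ℝ (fderiv ℝ u) y d d) 0 := by
    intro u y d hu hy
    have h1 := hu.eventually_hasDerivAt_line d
    have h2 := hu.hasDerivAt_fderiv_line d
    have hy' : 0 < u (y + (0 : ℝ) • d) := by simpa using hy
    refine ⟨eventually_hasDerivAt_powPrim_comp (f := fun s : ℝ => u (y + s • d)) hy' h1, ?_⟩
    have h3 := hasDerivAt_deriv_powPrim_comp (p := p) (f := fun s : ℝ => u (y + s • d))
      (f' := fun s : ℝ => fderiv ℝ u (y + s • d) d) hy' h1.self_of_nhds h2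
    simpa using h3
  obtain ⟨a1, a2⟩ := data e hφ hm
  obtain ⟨b1, b2⟩ := data e₀ hu₀ h₀
  obtain ⟨c1, c2⟩ := data e₁ hu₁ h₁
  have hc : ∀ y d : E, Tendsto (fun s : ℝ => y + s • d) (𝓝 0) (𝓝 y) := fun y d => by
    simpa using (hasDerivAt_line y d 0).continuousAt.tendsto
  -- `powPrim p` is increasing and turns the `p`-mean into an arithmetic mean, so touching becomes
  -- minimality of a difference that vanishes at `0`.
  have hmin : IsLocalMin (fun s : ℝ => powPrim p (φ (x + s • e)) -
      ((1 - μ) * powPrim p (u₀ (x₀ + s • e₀)) + μ * powPrim p (u₁ (x₁ + s • e₁)))) 0 := by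
    have ev := ((hc x₀ e₀).prodMk_nhds (hc x₁ e₁)).eventually hle
    have e0 := (hc x₀ e₀).eventually (hu₀.continuousAt.eventually (lt_mem_nhds h₀))
    have e1 := (hc x₁ e₁).eventually (hu₁.continuousAt.eventually (lt_mem_nhds h₁))
    filter_upwards [ev, e0, e1] with s hs hs0 hs1
    have hz : (1 - μ) • (x₀ + s • e₀) + μ • (x₁ + s • e₁) = x + s • e := by
      rw [hx, he]; module
    simp only [hz] at hs
    have := powPrim_le_powPrim hp (powMean_pos hμ hp hs0 hs1) hs
    rw [powPrim_powMean hμ hp hs0 hs1] at this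
    simp only [zero_smul, add_zero]
    rw [heq, powPrim_powMean hμ hp h₀ h₁]
    linarith
  have D1 : ∀ᶠ s : ℝ in 𝓝 0, HasDerivAt (fun s : ℝ => powPrim p (φ (x + s • e)) -
      ((1 - μ) * powPrim p (u₀ (x₀ + s • e₀)) + μ * powPrim p (u₁ (x₁ + s • e₁))))
      (φ (x + s • e) ^ (p - 1) * fderiv ℝ φ (x + s • e) e -
        ((1 - μ) * (u₀ (x₀ + s • e₀) ^ (p - 1) * fderiv ℝ u₀ (x₀ + s • e₀) e₀) +
          μ * (u₁ (x₁ + s • e₁) ^ (p - 1) * fderiv ℝ u₁ (x₁ + s • e₁) e₁))) s := by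
    filter_upwards [a1, b1, c1] with s ha hb hc
    exact ha.sub ((hb.const_mul _).add (hc.const_mul _))
  have D2 := a2.sub ((b2.const_mul (1 - μ)).add (c2.const_mul μ))
  have g := hmin.second_deriv_nonneg D1 D2
  have g' := hmin.hasDerivAt_eq_zero D1.self_of_nhds
  simp only [zero_smul, add_zero] at g'
  exact ⟨by linarith, by linarith⟩

/-- Moving only one of the two points isolates its first order condition. -/
theorem touching_fderiv (hμ : μ ∈ Ioo (0 : ℝ) 1) (hp : 0 ≤ p)
    (hu₀ : ContDiffAt ℝ 2 u₀ x₀) (hu₁ : ContDiffAt ℝ 2 u₁ x₁) (hφ : ContDiffAt ℝ 2 φ x)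
    (h₀ : 0 < u₀ x₀) (h₁ : 0 < u₁ x₁) (hx : x = (1 - μ) • x₀ + μ • x₁)
    (heq : φ x = powMean p (u₀ x₀) (u₁ x₁) μ)
    (hle : ∀ᶠ z in 𝓝 (x₀, x₁), powMean p (u₀ z.1) (u₁ z.2) μ ≤ φ ((1 - μ) • z.1 + μ • z.2))
    (e : E) :
    u₀ x₀ ^ (p - 1) * fderiv ℝ u₀ x₀ e = φ x ^ (p - 1) * fderiv ℝ φ x e ∧
      u₁ x₁ ^ (p - 1) * fderiv ℝ u₁ x₁ e = φ x ^ (p - 1) * fderiv ℝ φ x e := by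
  have h1 : 1 - μ ≠ 0 := by linarith [hμ.2]
  have h2 := hμ.1.ne'
  have a := (touching_line_conditions hμ hp hu₀ hu₁ hφ h₀ h₁ hx heq hle
    (e₀ := e) (e₁ := 0) rfl).1
  have b := (touching_line_conditions hμ hp hu₀ hu₁ hφ h₀ h₁ hx heq hle
    (e₀ := 0) (e₁ := e) rfl).1
  simp only [smul_zero, add_zero, zero_add, map_zero, mul_zero, map_smul, smul_eq_mul] at a b
  exact ⟨mul_left_cancel₀ h1 (by linarith), mul_left_cancel₀ h2 (by linarith)⟩

/-- The choice of speeds for the two points cancels every gradient term, leaving an inequality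
between second derivatives alone. -/
theorem touching_second_fderiv (hμ : μ ∈ Ioo (0 : ℝ) 1) (hp : 0 ≤ p)
    (hu₀ : ContDiffAt ℝ 2 u₀ x₀) (hu₁ : ContDiffAt ℝ 2 u₁ x₁) (hφ : ContDiffAt ℝ 2 φ x)
    (h₀ : 0 < u₀ x₀) (h₁ : 0 < u₁ x₁) (hx : x = (1 - μ) • x₀ + μ • x₁)
    (heq : φ x = powMean p (u₀ x₀) (u₁ x₁) μ)
    (hle : ∀ᶠ z in 𝓝 (x₀, x₁), powMean p (u₀ z.1) (u₁ z.2) μ ≤ φ ((1 - μ) • z.1 + μ • z.2))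
    (e : E) :
    φ x ^ (1 - 3 * p) * ((1 - μ) * (u₀ x₀ ^ (3 * p - 1) * fderiv ℝ (fderiv ℝ u₀) x₀ e e) +
      μ * (u₁ x₁ ^ (3 * p - 1) * fderiv ℝ (fderiv ℝ u₁) x₁ e e)) ≤
      fderiv ℝ (fderiv ℝ φ) x e e := by
  have hm : 0 < φ x := heq ▸ powMean_pos hμ hp h₀ h₁
  obtain ⟨g0, g1⟩ := touching_fderiv hμ hp hu₀ hu₁ hφ h₀ h₁ hx heq hle e
  have hM : φ x ^ p = (1 - μ) * u₀ x₀ ^ p + μ * u₁ x₁ ^ p := heq ▸ powMean_rpow_self hμ hp h₀ h₁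
  -- The weights `uᵢ ^ p / φ ^ p` average to `1` because `φ ^ p` is the arithmetic mean of the `uᵢ ^
  -- p`.
  have key := (touching_line_conditions hμ hp hu₀ hu₁ hφ h₀ h₁ hx heq hle
    (e₀ := (u₀ x₀ ^ p / φ x ^ p) • e) (e₁ := (u₁ x₁ ^ p / φ x ^ p) • e) (e := e) (by
      have hne : φ x ^ p ≠ 0 := (Real.rpow_pos_of_pos hm p).ne'
      rw [smul_smul, smul_smul, ← add_smul, ← mul_div_assoc, ← mul_div_assoc, ← add_div, ← hM,
        div_self hne, one_smul])).2
  simp only [map_smul, smul_eq_mul, smul_apply] at key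
  have r1 : ∀ t : ℝ, 0 < t → t ^ (p - 1) = t ^ p / t := fun t ht => Real.rpow_sub_one ht.ne' p
  have r2 : ∀ t : ℝ, 0 < t → t ^ (p - 2) = t ^ p / t ^ 2 := fun t ht => by
    rw [Real.rpow_sub ht]; norm_num
  have r3 : ∀ t : ℝ, 0 < t → t ^ (3 * p) = (t ^ p) ^ 3 := fun t ht => by
    rw [mul_comm, Real.rpow_mul ht.le]; norm_num
  have r4 : ∀ t : ℝ, 0 < t → t ^ (3 * p - 1) = (t ^ p) ^ 3 / t := fun t ht => by
    rw [Real.rpow_sub_one ht.ne', r3 t ht]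
  have r5 : ∀ t : ℝ, 0 < t → t ^ (1 - 3 * p) = t / (t ^ p) ^ 3 := fun t ht => by
    rw [Real.rpow_sub ht, r3 t ht, Real.rpow_one]
  rw [r5 _ hm, r4 _ h₀, r4 _ h₁]
  simp only [r1 _ hm, r1 _ h₀, r1 _ h₁, r2 _ hm, r2 _ h₀, r2 _ h₁] at key g0 g1
  have A0 := Real.rpow_pos_of_pos h₀ p
  have B0 := Real.rpow_pos_of_pos h₁ p
  have M0 := Real.rpow_pos_of_pos hm p
  generalize fderiv ℝ (fderiv ℝ u₀) x₀ e e = X at *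
  generalize fderiv ℝ (fderiv ℝ u₁) x₁ e e = Y at *
  generalize fderiv ℝ (fderiv ℝ φ) x e e = Z at *
  generalize fderiv ℝ u₀ x₀ e = x' at *
  generalize fderiv ℝ u₁ x₁ e = y' at *
  generalize fderiv ℝ φ x e = z' at *
  clear hle
  generalize u₀ x₀ ^ p = A at *
  generalize u₁ x₁ ^ p = B at *
  generalize φ x ^ p = M at *
  clear heq hu₀ hu₁ hφ hx
  generalize u₀ x₀ = a at *
  generalize u₁ x₁ = b at *
  generalize φ x = m at *
  set α := M / m * z' with hα
  have hx' : x' = a / A * α := by rw [← g0]; field_simp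
  have hy' : y' = b / B * α := by rw [← g1]; field_simp
  have hz' : z' = m / M * α := by rw [hα]; field_simp
  -- With the common first order quantity `α`, each gradient term is `(p - 1)α²/M²` times `A`, `B`
  -- or `M`, so `hM` makes them cancel.
  have c0 : (p - 1) * (M / m ^ 2) * z' ^ 2 - (1 - μ) * ((p - 1) * (A / a ^ 2) * (A / M * x') ^ 2) -
      μ * ((p - 1) * (B / b ^ 2) * (B / M * y') ^ 2) = 0 := by
    have : (p - 1) * (M / m ^ 2) * z' ^ 2 - (1 - μ) * ((p - 1) * (A / a ^ 2) * (A / M * x') ^ 2) -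
      μ * ((p - 1) * (B / b ^ 2) * (B / M * y') ^ 2) =
        (p - 1) * α ^ 2 / M ^ 2 * (M - ((1 - μ) * A + μ * B)) := by
      rw [hx', hy', hz']; field_simp; ring
    rw [this, ← hM, sub_self, mul_zero]
  have c1 : 0 ≤ M / m * (Z - m / M ^ 3 * ((1 - μ) * (A ^ 3 / a * X) + μ * (B ^ 3 / b * Y))) := by
    have : M / m * (Z - m / M ^ 3 * ((1 - μ) * (A ^ 3 / a * X) + μ * (B ^ 3 / b * Y))) =
        M / m * Z - (1 - μ) * (A / a * (A / M * (A / M * X))) -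
          μ * (B / b * (B / M * (B / M * Y))) := by
      field_simp; ring
    rw [this]
    linarith
  have := nonneg_of_mul_nonneg_right c1 (div_pos M0 hm)
  linarith

end Touching

end SecondOrder

/-! ### From touching conditions to the differential inequality -/

section Subsolution

variable {n : ℕ} {p μ : ℝ}

theorem dotProduct_hessianMatrix_mulVec (u : EucSpace n → ℝ) (x : EucSpace n) (v : Fin n → ℝ) :
    v ⬝ᵥ (hessianMatrix u x).mulVec v =
      fderiv ℝ (fderiv ℝ u) x (WithLp.toLp 2 v) (WithLp.toLp 2 v) := by
  have hv : WithLp.toLp 2 v = ∑ i, v i • EuclideanSpace.single i (1 : ℝ) := by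
    ext j
    simp [Finset.sum_apply, Pi.single_apply]
  rw [hv]
  simp only [map_sum, map_smul, sum_apply, smul_apply,
    dotProduct, Matrix.mulVec, hessianMatrix, Matrix.of_apply, iteratedFDeriv_two_apply,
    Matrix.cons_val_zero, Matrix.cons_val_one, smul_eq_mul, Finset.mul_sum]
  refine Finset.sum_comm.trans (Finset.sum_congr rfl fun i _ => Finset.sum_congr rfl fun j _ => ?_)
  ring

theorem ContDiffAt.hessianMatrix_isSymm {u : EucSpace n → ℝ} {x : EucSpace n}
    (hu : ContDiffAt ℝ 2 u x) : (hessianMatrix u x).IsSymm := by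
  ext i j
  simp only [hessianMatrix, Matrix.transpose_apply, Matrix.of_apply, iteratedFDeriv_two_apply,
    Matrix.cons_val_zero, Matrix.cons_val_one]
  exact (hu.isSymmSndFDerivAt (by simp)).eq _ _

/-- The substitution under which `transformedOp` is expressed: `t = u ^ p`, or `t = log u`. -/
noncomputable def powTrans (p u : ℝ) : ℝ := if p = 0 then Real.log u else u ^ p

theorem powTrans_mem_transformedRange {u : ℝ} (hu : 0 < u) :
    powTrans p u ∈ transformedRange p := by
  unfold powTrans transformedRange
  split_ifs
  · trivial
  · exact Real.rpow_pos_of_pos hu p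

theorem powTrans_powMean (hμ : μ ∈ Ioo (0 : ℝ) 1) (hp : 0 ≤ p) {a b : ℝ} (ha : 0 < a)
    (hb : 0 < b) : powTrans p (powMean p a b μ) = (1 - μ) * powTrans p a + μ * powTrans p b := by
  by_cases h : p = 0
  · subst h
    simpa [powPrim, powTrans] using powPrim_powMean hμ le_rfl ha hb
  · simpa [powTrans, h] using powMean_rpow_self hμ hp ha hb

/-- In terms of `u` instead of `t`, the definitions for `p = 0` and `p > 0` merge into one formula.
-/
theorem transformedOp_powTrans (F : SecondOrderOp n) (θ x : EucSpace n) {u : ℝ} (hu : 0 < u)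
    (A : Matrix (Fin n) (Fin n) ℝ) :
    transformedOp F p θ x (powTrans p u) A = F x u (u ^ (1 - p) • θ) (u ^ (1 - 3 * p) • A) := by
  by_cases h : p = 0
  · subst h
    simp [transformedOp, powTrans, Real.exp_log hu]
  · have e1 : p * (1 / p - 1) = 1 - p := by field_simp
    have e2 : p * (1 / p - 3) = 1 - 3 * p := by field_simp
    simp [transformedOp, powTrans, h, ← Real.rpow_mul hu.le, e1, e2,
      -one_div, mul_one_div_cancel h]

theorem AssumptionA.nonneg_of_touching {Ω₀ Ω₁ : Set (EucSpace n)} {F₀ F₁ Fμ : SecondOrderOp n}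
    (hA : AssumptionA μ p Ω₀ Ω₁ F₀ F₁ Fμ) (hμ : μ ∈ Ioo (0 : ℝ) 1) (hp : 0 ≤ p)
    (hFμ : IsProperElliptic (minkowskiComb μ Ω₀ Ω₁) Fμ) {u₀ u₁ φ : EucSpace n → ℝ}
    {x₀ x₁ x : EucSpace n} (hx₀ : x₀ ∈ Ω₀) (hx₁ : x₁ ∈ Ω₁) (hx : x = (1 - μ) • x₀ + μ • x₁)
    (hu₀ : ContDiffAt ℝ 2 u₀ x₀) (hu₁ : ContDiffAt ℝ 2 u₁ x₁) (hφ : ContDiffAt ℝ 2 φ x)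
    (h₀ : 0 < u₀ x₀) (h₁ : 0 < u₁ x₁)
    (hF₀ : F₀ x₀ (u₀ x₀) (∇ u₀ x₀) (hessianMatrix u₀ x₀) = 0)
    (hF₁ : F₁ x₁ (u₁ x₁) (∇ u₁ x₁) (hessianMatrix u₁ x₁) = 0)
    (heq : φ x = powMean p (u₀ x₀) (u₁ x₁) μ)
    (hle : ∀ᶠ z in 𝓝 (x₀, x₁), powMean p (u₀ z.1) (u₁ z.2) μ ≤ φ ((1 - μ) • z.1 + μ • z.2)) :
    0 ≤ Fμ x (φ x) (∇ φ x) (hessianMatrix φ x) := by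
  have hm : 0 < φ x := heq ▸ powMean_pos hμ hp h₀ h₁
  have hxΩ : x ∈ minkowskiComb μ Ω₀ Ω₁ :=
    hx ▸ add_mem_add (smul_mem_smul_set hx₀) (smul_mem_smul_set hx₁)
  have gr : ∀ (u : EucSpace n → ℝ) (y e : EucSpace n), inner ℝ (∇ u y) e = fderiv ℝ u y e :=
    fun u y e => InnerProductSpace.toDual_symm_apply
  have cancel : ∀ {t : ℝ}, 0 < t → ∀ a b : ℝ, a + b = 0 → t ^ a * t ^ b = 1 := by
    intro t ht a b hab
    rw [← Real.rpow_add ht, hab, Real.rpow_zero]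
  -- The common vector given by `touching_fderiv`; rescaling it recovers all three gradients.
  set θ := φ x ^ (p - 1) • ∇ φ x with hθ
  have hθφ : φ x ^ (1 - p) • θ = ∇ φ x := by
    rw [hθ, smul_smul, cancel hm _ _ (by ring), one_smul]
  have hθ₀ : u₀ x₀ ^ (1 - p) • θ = ∇ u₀ x₀ := by
    refine ext_inner_right ℝ fun e => ?_
    have := (touching_fderiv hμ hp hu₀ hu₁ hφ h₀ h₁ hx heq hle e).1
    rw [hθ, real_inner_smul_left, real_inner_smul_left, gr, gr, ← this, ← mul_assoc,
      cancel h₀ _ _ (by ring), one_mul]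
  have hθ₁ : u₁ x₁ ^ (1 - p) • θ = ∇ u₁ x₁ := by
    refine ext_inner_right ℝ fun e => ?_
    have := (touching_fderiv hμ hp hu₀ hu₁ hφ h₀ h₁ hx heq hle e).2
    rw [hθ, real_inner_smul_left, real_inner_smul_left, gr, gr, ← this, ← mul_assoc,
      cancel h₁ _ _ (by ring), one_mul]
  -- The power `3p - 1` cancels the factor `u ^ (1 - 3p)` inside `transformedOp`, so the equations
  -- for `u₀` and `u₁` apply literally.
  set A₀ := u₀ x₀ ^ (3 * p - 1) • hessianMatrix u₀ x₀ with hA₀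
  set A₁ := u₁ x₁ ^ (3 * p - 1) • hessianMatrix u₁ x₁ with hA₁
  have sA₀ : A₀.IsSymm := hu₀.hessianMatrix_isSymm.smul _
  have sA₁ : A₁.IsSymm := hu₁.hessianMatrix_isSymm.smul _
  have key := hA θ x₀ hx₀ x₁ hx₁ _ (powTrans_mem_transformedRange h₀) _
    (powTrans_mem_transformedRange h₁) A₀ A₁ sA₀ sA₁
  rw [← powTrans_powMean hμ hp h₀ h₁, ← heq, ← hx, transformedOp_powTrans _ _ _ h₀,
    transformedOp_powTrans _ _ _ h₁, transformedOp_powTrans _ _ _ hm, hθφ, hθ₀, hθ₁, hA₀, hA₁,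
    smul_smul, smul_smul, cancel h₀ _ _ (by ring), cancel h₁ _ _ (by ring), one_smul, one_smul,
    hF₀, hF₁, min_self, ← hA₀, ← hA₁] at key
  have sA : (φ x ^ (1 - 3 * p) • ((1 - μ) • A₀ + μ • A₁)).IsSymm :=
    ((sA₀.smul _).add (sA₁.smul _)).smul _
  have sφ := hφ.hessianMatrix_isSymm
  refine key.trans (hFμ.elliptic x hxΩ _ hm.le _ _ _ sA sφ ?_)
  refine .of_dotProduct_mulVec_nonneg ?_ fun v => ?_
  · exact (sφ.sub sA)
  · have := touching_second_fderiv hμ hp hu₀ hu₁ hφ h₀ h₁ hx heq hle (WithLp.toLp 2 v)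
    rw [← dotProduct_hessianMatrix_mulVec, ← dotProduct_hessianMatrix_mulVec,
      ← dotProduct_hessianMatrix_mulVec] at this
    simp only [star_trivial, Matrix.sub_mulVec, Matrix.smul_mulVec, Matrix.add_mulVec,
      dotProduct_sub, dotProduct_add, dotProduct_smul, smul_eq_mul, hA₀, hA₁]
    linarith

end Subsolution

/-! ### The supremal convolution as a viscosity subsolution -/

section SupConvolution

variable {n : ℕ} {p μ : ℝ} {Ω Ω₀ Ω₁ : Set (EucSpace n)} {u u₀ u₁ : EucSpace n → ℝ}

/-- Lets the boundary argument for `Ω₀` serve for `Ω₁` with the roles exchanged. -/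
theorem powMean_swap (a b : ℝ) : powMean p a b μ = powMean p b a (1 - μ) := by
  simp only [powMean, sub_sub_cancel, mul_comm a b]
  split_ifs
  · rw [mul_comm]
  · rfl
  · rw [add_comm]

theorem IsPositiveDirichlet.nonneg (hu : IsPositiveDirichlet Ω u) {x : EucSpace n}
    (hx : x ∈ closure Ω) : 0 ≤ u x := by
  by_cases h : x ∈ Ω
  · exact (hu.pos x h).le
  · exact (hu.boundary x ⟨hx, fun h' => h (interior_subset h')⟩).ge

theorem IsPositiveDirichlet.eq_zero (hu : IsPositiveDirichlet Ω u) {x : EucSpace n}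
    (hx : x ∈ closure Ω) (hx' : x ∉ Ω) : u x = 0 :=
  hu.boundary x ⟨hx, fun h => hx' (interior_subset h)⟩

/-- Positive inward derivatives force at least linear growth away from a boundary point. -/
theorem InwardDerivLiminfPos.exists_linear_growth (hlim : InwardDerivLiminfPos Ω u)
    (hΩ : IsOpen Ω) (hconv : Convex ℝ Ω) (hu : IsPositiveDirichlet Ω u)
    (hdiff : DifferentiableOn ℝ u Ω) {x y : EucSpace n} (hx : x ∈ frontier Ω) (hy : y ∈ Ω) :
    ∃ c, 0 < c ∧ ∀ᶠ t : ℝ in 𝓝[>] 0, x + t • (y - x) ∈ Ω ∧ c * t ≤ u (x + t • (y - x)) := by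
  set ν := y - x with hν
  have hseg : ∀ t ∈ Ioc (0 : ℝ) 1, x + t • ν ∈ Ω := fun t ht => by
    have := hconv.add_smul_sub_mem_interior' hx.1 (hΩ.interior_eq.symm ▸ hy) ht
    rwa [hΩ.interior_eq] at this
  have hin : IsInwardDirection Ω x ν := ⟨1, one_pos, hseg 1 ⟨one_pos, le_rfl⟩⟩
  obtain ⟨c, hc0, hc⟩ := EReal.lt_iff_exists_real_btwn.1 (hlim x hx ν hin)
  have hc0 : 0 < c := by exact_mod_cast hc0
  have hev := eventually_lt_of_lt_liminf hc
  have h01 : ∀ᶠ t : ℝ in 𝓝[>] 0, t ∈ Ioc (0 : ℝ) 1 := Ioc_mem_nhdsGT one_pos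
  have htend : Tendsto (fun t : ℝ => x + t • ν) (𝓝[>] 0) (𝓝[Ω] x) := by
    refine tendsto_nhdsWithin_iff.2 ⟨?_, h01.mono hseg⟩
    have := (hasDerivAt_line x ν 0).continuousAt.tendsto
    simp only [zero_smul, add_zero] at this
    exact this.mono_left nhdsWithin_le_nhds
  have hev' := (htend.eventually hev).and h01
  obtain ⟨δ, hδ, hsub⟩ := mem_nhdsGT_iff_exists_Ioo_subset.1 hev'
  refine ⟨c, hc0, ?_⟩
  filter_upwards [h01, Ioo_mem_nhdsGT hδ] with t ht ht'
  refine ⟨hseg t ht, ?_⟩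
  have hd : ∀ s ∈ Ioc (0 : ℝ) 1, HasDerivAt (fun s : ℝ => u (x + s • ν))
      (fderiv ℝ u (x + s • ν) ν) s := fun s hs =>
    ((hdiff.differentiableAt (hΩ.mem_nhds (hseg s hs))).hasFDerivAt).comp_hasDerivAt s
      (hasDerivAt_line x ν s)
  have hcont : ContinuousOn (fun s : ℝ => u (x + s • ν)) (Icc 0 t) := by
    refine hu.continuousOn.comp (by fun_prop) fun s hs => ?_
    rcases hs.1.eq_or_lt with rfl | h
    · simpa using hx.1
    · exact subset_closure (hseg s ⟨h, hs.2.trans ht.2⟩)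
  -- Mean value inequality along the segment from the boundary point, where `u` vanishes.
  have := (convex_Icc (0 : ℝ) t).mul_sub_le_image_sub_of_le_deriv hcont
    (fun s hs => by
      rw [interior_Icc] at hs
      exact (hd s ⟨hs.1, hs.2.le.trans ht.2⟩).differentiableAt.differentiableWithinAt)
    (C := c) (fun s hs => by
      rw [interior_Icc] at hs
      rw [(hd s ⟨hs.1, hs.2.le.trans ht.2⟩).deriv]
      have h := (hsub ⟨hs.1, hs.2.trans ht'.2⟩).1
      exact (EReal.coe_lt_coe_iff.1 h).le)
    0 ⟨le_rfl, ht.1.le⟩ t ⟨ht.1.le, le_rfl⟩ ht.1.le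
  simpa [hu.boundary x hx] using this

/-- A pair with one boundary point never maximises the `p`-mean, for `0 < p < 1`. -/
theorem exists_powMean_gt_of_frontier (hμ : μ ∈ Ioo (0 : ℝ) 1) (hp : p ∈ Ioo (0 : ℝ) 1)
    (hΩ₀ : IsOpen Ω₀) (hconv : Convex ℝ Ω₀) (hne : Ω₀.Nonempty) (hu₀ : IsPositiveDirichlet Ω₀ u₀)
    (hdiff₀ : DifferentiableOn ℝ u₀ Ω₀) (hlim : InwardDerivLiminfPos Ω₀ u₀)
    (hΩ₁ : IsOpen Ω₁) {x₀ x₁ : EucSpace n} (hx₀ : x₀ ∈ frontier Ω₀) (hx₁ : x₁ ∈ Ω₁)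
    (hdiff₁ : DifferentiableAt ℝ u₁ x₁) (hpos : 0 < u₁ x₁) :
    ∃ y₀ ∈ Ω₀, ∃ y₁ ∈ Ω₁, (1 - μ) • y₀ + μ • y₁ = (1 - μ) • x₀ + μ • x₁ ∧
      powMean p (u₀ x₀) (u₁ x₁) μ < powMean p (u₀ y₀) (u₁ y₁) μ := by
  have h1 : 0 < 1 - μ := by linarith [hμ.2]
  have h2 := hμ.1
  have hp0 := hp.1
  obtain ⟨y, hy⟩ := hne
  obtain ⟨c, hc, hgrow⟩ := hlim.exists_linear_growth hΩ₀ hconv hu₀ hdiff₀ hx₀ hy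
  set ν := y - x₀
  -- Chosen so that `(1 - μ)ν + μe = 0`: moving both points keeps their combination fixed.
  set e := (-((1 - μ) / μ)) • ν with he
  have hline : Tendsto (fun t : ℝ => x₁ + t • e) (𝓝[>] 0) (𝓝 x₁) := by
    have := (hasDerivAt_line x₁ e 0).continuousAt.tendsto
    simp only [zero_smul, add_zero] at this
    exact this.mono_left nhdsWithin_le_nhds
  have hmem := hline.eventually (hΩ₁.mem_nhds hx₁)
  have hG : DifferentiableAt ℝ (fun t : ℝ => u₁ (x₁ + t • e) ^ p) 0 := by
    have hu : DifferentiableAt ℝ (fun t : ℝ => u₁ (x₁ + t • e)) 0 := by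
      have h3 : DifferentiableAt ℝ u₁ (x₁ + (0 : ℝ) • e) := by simpa using hdiff₁
      exact (h3.hasFDerivAt.comp_hasDerivAt (0 : ℝ) (hasDerivAt_line x₁ e 0)).differentiableAt
    exact hu.rpow_const (.inl (by simpa using hpos.ne'))
  obtain ⟨L, hL0, hL⟩ := hG.isBigO_sub.exists_pos
  have hL' := (hL.bound).filter_mono (nhdsWithin_le_nhds (s := Ioi 0))
  -- Since `p < 1`, the gain `(1 - μ)c ^ p t ^ p` at the boundary point eventually exceeds the loss
  -- `μLt` at the interior one.
  have hsmall : ∀ᶠ t : ℝ in 𝓝[>] 0, μ * L * t ^ (1 - p) < (1 - μ) * c ^ p := by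
    have hcont : Continuous fun t : ℝ => μ * L * t ^ (1 - p) :=
      continuous_const.mul (continuous_id.rpow_const fun _ => .inr (by linarith [hp.2]))
    have := (hcont.tendsto 0).mono_left (nhdsWithin_le_nhds (s := Ioi 0))
    rw [Real.zero_rpow (by linarith [hp.2]), mul_zero] at this
    exact this.eventually (gt_mem_nhds (by positivity))
  obtain ⟨t, ⟨⟨⟨⟨ht1, ht2⟩, ht3⟩, ht5⟩, ht6⟩, ht0⟩ :=
    ((((hgrow.and hmem).and hL').and hsmall).and self_mem_nhdsWithin).exists
  have ht0 : 0 < t := ht0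
  refine ⟨_, ht1, _, ht3, ?_, ?_⟩
  · have : μ * ((1 - μ) / μ) = 1 - μ := by field_simp
    rw [he, smul_add, smul_add, smul_smul, smul_smul, smul_smul]
    have h3 : μ * t * -((1 - μ) / μ) = -((1 - μ) * t) := by linear_combination (-t) * this
    rw [h3]
    module
  · rw [powMean_of_pos hp0, powMean_of_pos hp0, hu₀.boundary x₀ hx₀, Real.zero_rpow hp0.ne']
    refine Real.rpow_lt_rpow (by positivity) ?_ (by positivity)
    have hf : c ^ p * t ^ p ≤ u₀ (x₀ + t • ν) ^ p := by
      rw [← Real.mul_rpow hc.le ht0.le]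
      exact Real.rpow_le_rpow (by positivity) ht2 hp0.le
    have hg : u₁ x₁ ^ p - L * t ≤ u₁ (x₁ + t • e) ^ p := by
      simp only [zero_smul, add_zero, sub_zero, Real.norm_eq_abs, abs_of_pos ht0] at ht5
      linarith [(abs_le.1 ht5).1]
    have ht : t ^ (1 - p) * t ^ p = t := by
      rw [← Real.rpow_add ht0]; simp
    have htp := Real.rpow_pos_of_pos ht0 p
    have h5 := mul_lt_mul_of_pos_right ht6 htp
    have h6 : μ * L * t ^ (1 - p) * t ^ p = μ * (L * t) := by linear_combination μ * L * ht
    have h7 := mul_le_mul_of_nonneg_left hf h1.le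
    have h8 := mul_le_mul_of_nonneg_left hg h2.le
    linarith

/-- The `p`-mean supremal convolution of `u₀` and `u₁`. -/
noncomputable def supConv (p μ : ℝ) (Ω₀ Ω₁ : Set (EucSpace n)) (u₀ u₁ : EucSpace n → ℝ)
    (x : EucSpace n) : ℝ :=
  sSup ((fun z : EucSpace n × EucSpace n => powMean p (u₀ z.1) (u₁ z.2) μ) ''
    {z | z ∈ closure Ω₀ ×ˢ closure Ω₁ ∧ (1 - μ) • z.1 + μ • z.2 = x})

theorem IsPositiveDirichlet.continuousOn_powMean (hμ : μ ∈ Ioo (0 : ℝ) 1) (hp : 0 ≤ p)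
    (hu₀ : IsPositiveDirichlet Ω₀ u₀) (hu₁ : IsPositiveDirichlet Ω₁ u₁) :
    ContinuousOn (fun z : EucSpace n × EucSpace n => powMean p (u₀ z.1) (u₁ z.2) μ)
      (closure Ω₀ ×ˢ closure Ω₁) :=
  (_root_.continuousOn_powMean hμ hp).comp
    ((hu₀.continuousOn.comp continuousOn_fst fun _ hz => hz.1).prodMk
      (hu₁.continuousOn.comp continuousOn_snd fun _ hz => hz.2))
    fun _ hz => ⟨hu₀.nonneg hz.1, hu₁.nonneg hz.2⟩

theorem continuous_comb (μ : ℝ) : Continuous fun z : EucSpace n × EucSpace n =>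
    (1 - μ) • z.1 + μ • z.2 := by fun_prop

theorem isOpen_minkowskiComb (hμ : μ ∈ Ioo (0 : ℝ) 1) (hΩ₁ : IsOpen Ω₁) :
    IsOpen (minkowskiComb μ Ω₀ Ω₁) :=
  (hΩ₁.smul₀ hμ.1.ne').add_left

theorem isCompact_closure_prod (hb₀ : Bornology.IsBounded Ω₀) (hb₁ : Bornology.IsBounded Ω₁) :
    IsCompact (closure Ω₀ ×ˢ closure Ω₁) :=
  hb₀.isCompact_closure.prod hb₁.isCompact_closure

theorem closure_minkowskiComb_subset (hb₀ : Bornology.IsBounded Ω₀)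
    (hb₁ : Bornology.IsBounded Ω₁) :
    closure (minkowskiComb μ Ω₀ Ω₁) ⊆
      (fun z : EucSpace n × EucSpace n => (1 - μ) • z.1 + μ • z.2) ''
        (closure Ω₀ ×ˢ closure Ω₁) := by
  refine closure_minimal ?_
    ((isCompact_closure_prod hb₀ hb₁).image (continuous_comb μ)).isClosed
  rintro _ ⟨_, ⟨x, hx, rfl⟩, _, ⟨y, hy, rfl⟩, rfl⟩
  exact ⟨(x, y), ⟨subset_closure hx, subset_closure hy⟩, rfl⟩

theorem comb_mem_minkowskiComb {z : EucSpace n × EucSpace n} (h₀ : z.1 ∈ Ω₀) (h₁ : z.2 ∈ Ω₁) :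
    (1 - μ) • z.1 + μ • z.2 ∈ minkowskiComb μ Ω₀ Ω₁ :=
  add_mem_add (smul_mem_smul_set h₀) (smul_mem_smul_set h₁)

/-- Adding the closure of a set to an open set gives nothing beyond adding the set itself. Hence
both components of a pair over a boundary point are boundary points. -/
theorem comb_mem_minkowskiComb_of_left (hμ : μ ∈ Ioo (0 : ℝ) 1) (hΩ₀ : IsOpen Ω₀)
    {z : EucSpace n × EucSpace n} (h₀ : z.1 ∈ Ω₀) (h₁ : z.2 ∈ closure Ω₁) :
    (1 - μ) • z.1 + μ • z.2 ∈ minkowskiComb μ Ω₀ Ω₁ := by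
  have hne : 1 - μ ≠ 0 := by linarith [hμ.2]
  unfold minkowskiComb
  rw [← (hΩ₀.smul₀ hne).add_closure, closure_smul₀' hμ.1.ne']
  exact add_mem_add (smul_mem_smul_set h₀) (smul_mem_smul_set h₁)

theorem comb_mem_minkowskiComb_of_right (hμ : μ ∈ Ioo (0 : ℝ) 1) (hΩ₁ : IsOpen Ω₁)
    {z : EucSpace n × EucSpace n} (h₀ : z.1 ∈ closure Ω₀) (h₁ : z.2 ∈ Ω₁) :
    (1 - μ) • z.1 + μ • z.2 ∈ minkowskiComb μ Ω₀ Ω₁ := by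
  have hne : 1 - μ ≠ 0 := by linarith [hμ.2]
  unfold minkowskiComb
  rw [← (hΩ₁.smul₀ hμ.1.ne').closure_add, closure_smul₀' hne]
  exact add_mem_add (smul_mem_smul_set h₀) (smul_mem_smul_set h₁)

theorem isCompact_powMean_image_fiber (hμ : μ ∈ Ioo (0 : ℝ) 1) (hp : 0 ≤ p)
    (hb₀ : Bornology.IsBounded Ω₀) (hb₁ : Bornology.IsBounded Ω₁)
    (hu₀ : IsPositiveDirichlet Ω₀ u₀) (hu₁ : IsPositiveDirichlet Ω₁ u₁) (x : EucSpace n) :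
    IsCompact ((fun z : EucSpace n × EucSpace n => powMean p (u₀ z.1) (u₁ z.2) μ) ''
      {z | z ∈ closure Ω₀ ×ˢ closure Ω₁ ∧ (1 - μ) • z.1 + μ • z.2 = x}) := by
  have hc := (isCompact_closure_prod hb₀ hb₁).inter_right
    (isClosed_singleton.preimage (continuous_comb (n := n) μ) (t := {x}))
  exact hc.image_of_continuousOn
    ((hu₀.continuousOn_powMean hμ hp hu₁).mono inter_subset_left)

theorem powMean_le_supConv (hμ : μ ∈ Ioo (0 : ℝ) 1) (hp : 0 ≤ p)
    (hb₀ : Bornology.IsBounded Ω₀) (hb₁ : Bornology.IsBounded Ω₁)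
    (hu₀ : IsPositiveDirichlet Ω₀ u₀) (hu₁ : IsPositiveDirichlet Ω₁ u₁)
    {z : EucSpace n × EucSpace n} (hz : z ∈ closure Ω₀ ×ˢ closure Ω₁) :
    powMean p (u₀ z.1) (u₁ z.2) μ ≤ supConv p μ Ω₀ Ω₁ u₀ u₁ ((1 - μ) • z.1 + μ • z.2) :=
  le_csSup (isCompact_powMean_image_fiber hμ hp hb₀ hb₁ hu₀ hu₁ _).bddAbove ⟨z, ⟨hz, rfl⟩, rfl⟩

theorem exists_eq_supConv (hμ : μ ∈ Ioo (0 : ℝ) 1) (hp : 0 ≤ p)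
    (hb₀ : Bornology.IsBounded Ω₀) (hb₁ : Bornology.IsBounded Ω₁)
    (hu₀ : IsPositiveDirichlet Ω₀ u₀) (hu₁ : IsPositiveDirichlet Ω₁ u₁) {x : EucSpace n}
    (hx : x ∈ closure (minkowskiComb μ Ω₀ Ω₁)) :
    ∃ z ∈ closure Ω₀ ×ˢ closure Ω₁, (1 - μ) • z.1 + μ • z.2 = x ∧
      powMean p (u₀ z.1) (u₁ z.2) μ = supConv p μ Ω₀ Ω₁ u₀ u₁ x := by
  obtain ⟨w, hw, hwx⟩ := closure_minkowskiComb_subset hb₀ hb₁ hx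
  obtain ⟨z, ⟨hz, hzx⟩, hz'⟩ := (isCompact_powMean_image_fiber hμ hp hb₀ hb₁ hu₀ hu₁ x).sSup_mem
    ⟨_, w, ⟨hw, hwx⟩, rfl⟩
  exact ⟨z, hz, hzx, hz'⟩

/-- Inside the Minkowski combination, the supremal convolution is attained at interior points. -/
theorem mem_of_eq_supConv (hμ : μ ∈ Ioo (0 : ℝ) 1) (hp : p ∈ Ico (0 : ℝ) 1)
    (hΩ₀ : IsOpen Ω₀) (hc₀ : Convex ℝ Ω₀) (hb₀ : Bornology.IsBounded Ω₀)
    (hΩ₁ : IsOpen Ω₁) (hc₁ : Convex ℝ Ω₁) (hb₁ : Bornology.IsBounded Ω₁)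
    (hu₀ : IsPositiveDirichlet Ω₀ u₀) (hu₁ : IsPositiveDirichlet Ω₁ u₁)
    (hd₀ : DifferentiableOn ℝ u₀ Ω₀) (hd₁ : DifferentiableOn ℝ u₁ Ω₁)
    (hlim : 0 < p → InwardDerivLiminfPos Ω₀ u₀ ∧ InwardDerivLiminfPos Ω₁ u₁)
    {z : EucSpace n × EucSpace n} (hz : z ∈ closure Ω₀ ×ˢ closure Ω₁)
    (hx : (1 - μ) • z.1 + μ • z.2 ∈ minkowskiComb μ Ω₀ Ω₁)
    (heq : powMean p (u₀ z.1) (u₁ z.2) μ =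
      supConv p μ Ω₀ Ω₁ u₀ u₁ ((1 - μ) • z.1 + μ • z.2)) : z.1 ∈ Ω₀ ∧ z.2 ∈ Ω₁ := by
  have hne1 : 1 - μ ≠ 0 := by linarith [hμ.2]
  obtain ⟨_, ⟨y₀, hy₀, rfl⟩, _, ⟨y₁, hy₁, rfl⟩, hy⟩ := hx
  have hmax : ∀ w ∈ closure Ω₀ ×ˢ closure Ω₁, (1 - μ) • w.1 + μ • w.2 = (1 - μ) • z.1 + μ • z.2 →
      powMean p (u₀ w.1) (u₁ w.2) μ ≤ powMean p (u₀ z.1) (u₁ z.2) μ := fun w hw hwz => by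
    rw [heq, ← hwz]
    exact powMean_le_supConv hμ hp.1 hb₀ hb₁ hu₀ hu₁ hw
  have hpos : 0 < powMean p (u₀ z.1) (u₁ z.2) μ :=
    (powMean_pos hμ hp.1 (hu₀.pos _ hy₀) (hu₁.pos _ hy₁)).trans_le
      (hmax (y₀, y₁) ⟨subset_closure hy₀, subset_closure hy₁⟩ hy)
  rcases hp.1.eq_or_lt with h0 | h0
  · subst h0
    rw [powMean_zero] at hpos
    constructor <;> by_contra h
    · simp [hu₀.eq_zero hz.1 h, Real.zero_rpow hne1] at hpos
    · simp [hu₁.eq_zero hz.2 h, Real.zero_rpow hμ.1.ne'] at hpos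
  · obtain ⟨hl₀, hl₁⟩ := hlim h0
    by_cases m₀ : z.1 ∈ Ω₀ <;> by_cases m₁ : z.2 ∈ Ω₁
    · exact ⟨m₀, m₁⟩
    · have hf : z.2 ∈ frontier Ω₁ := ⟨hz.2, by rwa [hΩ₁.interior_eq]⟩
      obtain ⟨w₁, hw₁, w₀, hw₀, hw, hlt⟩ := exists_powMean_gt_of_frontier (μ := 1 - μ) (p := p)
        (by constructor <;> linarith [hμ.1, hμ.2]) ⟨h0, hp.2⟩ hΩ₁ hc₁ ⟨y₁, hy₁⟩ hu₁ hd₁ hl₁ hΩ₀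
        hf m₀ (hd₀.differentiableAt (hΩ₀.mem_nhds m₀)) (hu₀.pos _ m₀)
      rw [← powMean_swap, ← powMean_swap] at hlt
      rw [sub_sub_cancel, add_comm, add_comm (μ • z.2)] at hw
      exact absurd (hmax (w₀, w₁) ⟨subset_closure hw₀, subset_closure hw₁⟩ hw) hlt.not_ge
    · have hf : z.1 ∈ frontier Ω₀ := ⟨hz.1, by rwa [hΩ₀.interior_eq]⟩
      obtain ⟨w₀, hw₀, w₁, hw₁, hw, hlt⟩ := exists_powMean_gt_of_frontier (μ := μ) (p := p)
        hμ ⟨h0, hp.2⟩ hΩ₀ hc₀ ⟨y₀, hy₀⟩ hu₀ hd₀ hl₀ hΩ₁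
        hf m₁ (hd₁.differentiableAt (hΩ₁.mem_nhds m₁)) (hu₁.pos _ m₁)
      exact absurd (hmax (w₀, w₁) ⟨subset_closure hw₀, subset_closure hw₁⟩ hw) hlt.not_ge
    · rw [hu₀.eq_zero hz.1 m₀, hu₁.eq_zero hz.2 m₁, powMean_zero_zero hμ hp.1] at hpos
      exact absurd hpos (lt_irrefl _)

theorem supConv_nonneg (hμ : μ ∈ Ioo (0 : ℝ) 1) (hp : 0 ≤ p)
    (hb₀ : Bornology.IsBounded Ω₀) (hb₁ : Bornology.IsBounded Ω₁)
    (hu₀ : IsPositiveDirichlet Ω₀ u₀) (hu₁ : IsPositiveDirichlet Ω₁ u₁) {x : EucSpace n}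
    (hx : x ∈ closure (minkowskiComb μ Ω₀ Ω₁)) : 0 ≤ supConv p μ Ω₀ Ω₁ u₀ u₁ x := by
  obtain ⟨z, hz, -, hzv⟩ := exists_eq_supConv hμ hp hb₀ hb₁ hu₀ hu₁ hx
  exact hzv ▸ powMean_nonneg hμ hp (hu₀.nonneg hz.1) (hu₁.nonneg hz.2)

theorem supConv_eq_zero (hμ : μ ∈ Ioo (0 : ℝ) 1) (hp : 0 ≤ p) (hΩ₀ : IsOpen Ω₀)
    (hΩ₁ : IsOpen Ω₁) (hb₀ : Bornology.IsBounded Ω₀) (hb₁ : Bornology.IsBounded Ω₁)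
    (hu₀ : IsPositiveDirichlet Ω₀ u₀) (hu₁ : IsPositiveDirichlet Ω₁ u₁) {x : EucSpace n}
    (hx : x ∈ closure (minkowskiComb μ Ω₀ Ω₁)) (hx' : x ∉ minkowskiComb μ Ω₀ Ω₁) :
    supConv p μ Ω₀ Ω₁ u₀ u₁ x = 0 := by
  obtain ⟨z, hz, rfl, hzv⟩ := exists_eq_supConv hμ hp hb₀ hb₁ hu₀ hu₁ hx
  have m₀ : z.1 ∉ Ω₀ := fun h => hx' (comb_mem_minkowskiComb_of_left hμ hΩ₀ h hz.2)
  have m₁ : z.2 ∉ Ω₁ := fun h => hx' (comb_mem_minkowskiComb_of_right hμ hΩ₁ hz.1 h)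
  rw [← hzv, hu₀.eq_zero hz.1 m₀, hu₁.eq_zero hz.2 m₁, powMean_zero_zero hμ hp]

/-- The bound from below follows by translating an interior optimal pair, or from nonnegativity at
boundary points. The bound from above holds because superlevel sets are continuous images of compact
sets. -/
theorem continuousOn_supConv (hμ : μ ∈ Ioo (0 : ℝ) 1) (hp : p ∈ Ico (0 : ℝ) 1)
    (hΩ₀ : IsOpen Ω₀) (hc₀ : Convex ℝ Ω₀) (hb₀ : Bornology.IsBounded Ω₀)
    (hΩ₁ : IsOpen Ω₁) (hc₁ : Convex ℝ Ω₁) (hb₁ : Bornology.IsBounded Ω₁)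
    (hu₀ : IsPositiveDirichlet Ω₀ u₀) (hu₁ : IsPositiveDirichlet Ω₁ u₁)
    (hd₀ : DifferentiableOn ℝ u₀ Ω₀) (hd₁ : DifferentiableOn ℝ u₁ Ω₁)
    (hlim : 0 < p → InwardDerivLiminfPos Ω₀ u₀ ∧ InwardDerivLiminfPos Ω₁ u₁) :
    ContinuousOn (supConv p μ Ω₀ Ω₁ u₀ u₁) (closure (minkowskiComb μ Ω₀ Ω₁)) := by
  intro x hx
  refine tendsto_order.2 ⟨fun c hc => ?_, fun c hc => ?_⟩
  · by_cases hxΩ : x ∈ minkowskiComb μ Ω₀ Ω₁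
    · obtain ⟨z, hz, rfl, hzv⟩ := exists_eq_supConv hμ hp.1 hb₀ hb₁ hu₀ hu₁ hx
      obtain ⟨m₀, m₁⟩ := mem_of_eq_supConv hμ hp hΩ₀ hc₀ hb₀ hΩ₁ hc₁ hb₁ hu₀ hu₁ hd₀ hd₁ hlim
        hz hxΩ hzv
      set x := (1 - μ) • z.1 + μ • z.2 with hxz
      have hnhds : closure Ω₀ ×ˢ closure Ω₁ ∈ 𝓝 z :=
        mem_of_superset ((hΩ₀.prod hΩ₁).mem_nhds ⟨m₀, m₁⟩) (prod_mono subset_closure subset_closure)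
      have hcont := (hu₀.continuousOn_powMean hμ hp.1 hu₁).continuousAt hnhds
      -- Shifting both points by `y - x` shifts their combination from `x` to `y`.
      have hshift : Tendsto (fun y => (z.1 + (y - x), z.2 + (y - x))) (𝓝 x) (𝓝 z) := by
        have : Continuous fun y => (z.1 + (y - x), z.2 + (y - x)) := by fun_prop
        simpa using this.tendsto x
      rw [← hzv] at hc
      refine Filter.Eventually.filter_mono nhdsWithin_le_nhds ?_
      filter_upwards [hshift.eventually hnhds, hshift.eventually (hcont.eventually (lt_mem_nhds hc))]
        with y h3 h4
      have := powMean_le_supConv hμ hp.1 hb₀ hb₁ hu₀ hu₁ h3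
      have hy : (1 - μ) • (z.1 + (y - x)) + μ • (z.2 + (y - x)) = y := by
        rw [hxz]; module
      rw [hy] at this
      exact h4.trans_le this
    · rw [supConv_eq_zero hμ hp.1 hΩ₀ hΩ₁ hb₀ hb₁ hu₀ hu₁ hx hxΩ] at hc
      filter_upwards [self_mem_nhdsWithin] with y hy
      exact hc.trans_le (supConv_nonneg hμ hp.1 hb₀ hb₁ hu₀ hu₁ hy)
  · have hS : IsCompact ((closure Ω₀ ×ˢ closure Ω₁) ∩
        {z | c ≤ powMean p (u₀ z.1) (u₁ z.2) μ}) := by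
      have hK := isCompact_closure_prod hb₀ hb₁
      exact hK.of_isClosed_subset ((hu₀.continuousOn_powMean hμ hp.1 hu₁).preimage_isClosed_of_isClosed
        hK.isClosed isClosed_Ici) inter_subset_left
    have hcl := (hS.image (continuous_comb μ)).isClosed
    have hxS : x ∈ ((fun z : EucSpace n × EucSpace n => (1 - μ) • z.1 + μ • z.2) ''
        ((closure Ω₀ ×ˢ closure Ω₁) ∩ {z | c ≤ powMean p (u₀ z.1) (u₁ z.2) μ}))ᶜ := by
      rintro ⟨z, ⟨hz, hcz⟩, rfl⟩
      exact hc.not_ge (hcz.trans (powMean_le_supConv hμ hp.1 hb₀ hb₁ hu₀ hu₁ hz))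
    filter_upwards [self_mem_nhdsWithin,
      mem_nhdsWithin_of_mem_nhds (hcl.isOpen_compl.mem_nhds hxS)] with y hy hyS
    obtain ⟨z, hz, hzy, hzv⟩ := exists_eq_supConv hμ hp.1 hb₀ hb₁ hu₀ hu₁ hy
    by_contra! hcon
    exact hyS ⟨z, ⟨hz, by rw [← hzv] at hcon; exact hcon⟩, hzy⟩

theorem isViscositySubsolution_supConv (hμ : μ ∈ Ioo (0 : ℝ) 1) (hp : p ∈ Ico (0 : ℝ) 1)
    (hΩ₀ : IsOpen Ω₀) (hc₀ : Convex ℝ Ω₀) (hb₀ : Bornology.IsBounded Ω₀)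
    (hΩ₁ : IsOpen Ω₁) (hc₁ : Convex ℝ Ω₁) (hb₁ : Bornology.IsBounded Ω₁)
    {F₀ F₁ Fμ : SecondOrderOp n} (hFμ : IsProperElliptic (minkowskiComb μ Ω₀ Ω₁) Fμ)
    (hu₀ : IsClassicalSolution Ω₀ F₀ u₀) (hu₁ : IsClassicalSolution Ω₁ F₁ u₁)
    (hA : AssumptionA μ p Ω₀ Ω₁ F₀ F₁ Fμ)
    (hlim : 0 < p → InwardDerivLiminfPos Ω₀ u₀ ∧ InwardDerivLiminfPos Ω₁ u₁) :
    IsViscositySubsolution (minkowskiComb μ Ω₀ Ω₁) Fμ (supConv p μ Ω₀ Ω₁ u₀ u₁) := by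
  have hd₀ := hu₀.contDiffOn.differentiableOn (by simp)
  have hd₁ := hu₁.contDiffOn.differentiableOn (by simp)
  have hP₀ := hu₀.toIsPositiveDirichlet
  have hP₁ := hu₁.toIsPositiveDirichlet
  refine ⟨((continuousOn_supConv hμ hp hΩ₀ hc₀ hb₀ hΩ₁ hc₁ hb₁ hP₀ hP₁ hd₀ hd₁ hlim).mono
    subset_closure).upperSemicontinuousOn, ?_⟩
  intro φ hφ x hx heq hle
  obtain ⟨z, hz, rfl, hzv⟩ := exists_eq_supConv hμ hp.1 hb₀ hb₁ hP₀ hP₁ (subset_closure hx)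
  obtain ⟨m₀, m₁⟩ := mem_of_eq_supConv hμ hp hΩ₀ hc₀ hb₀ hΩ₁ hc₁ hb₁ hP₀ hP₁ hd₀ hd₁ hlim
    hz hx hzv
  rw [← heq]
  refine hA.nonneg_of_touching hμ hp.1 hFμ m₀ m₁ rfl (hu₀.contDiffOn.contDiffAt (hΩ₀.mem_nhds m₀))
    (hu₁.contDiffOn.contDiffAt (hΩ₁.mem_nhds m₁))
    (hφ.contDiffAt ((isOpen_minkowskiComb hμ hΩ₁).mem_nhds hx)) (hu₀.pos _ m₀) (hu₁.pos _ m₁)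
    (hu₀.equation _ m₀) (hu₁.equation _ m₁) (heq.trans hzv.symm) ?_
  -- The test function dominates `w` near `x`, hence the mean of the two values for all pairs near
  -- `z`.
  have hev := (continuous_comb (n := n) μ).continuousAt (x := z) |>.eventually hle
  filter_upwards [hev, (hΩ₀.prod hΩ₁).mem_nhds (x := z) ⟨m₀, m₁⟩] with w h3 h4
  exact (powMean_le_supConv hμ hp.1 hb₀ hb₁ hP₀ hP₁
    ⟨subset_closure h4.1, subset_closure h4.2⟩).trans h3

/-- The `p`-mean of two solutions is dominated by a solution in the Minkowski combination. -/
theorem powMean_le_solution (hμ : μ ∈ Ioo (0 : ℝ) 1) (hp : p ∈ Ico (0 : ℝ) 1)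
    (hΩ₀ : IsOpen Ω₀) (hc₀ : Convex ℝ Ω₀) (hb₀ : Bornology.IsBounded Ω₀)
    (hΩ₁ : IsOpen Ω₁) (hc₁ : Convex ℝ Ω₁) (hb₁ : Bornology.IsBounded Ω₁)
    {F₀ F₁ Fμ : SecondOrderOp n} (hFμ : IsProperElliptic (minkowskiComb μ Ω₀ Ω₁) Fμ)
    (hu₀ : IsClassicalSolution Ω₀ F₀ u₀) (hu₁ : IsClassicalSolution Ω₁ F₁ u₁)
    {uμ : EucSpace n → ℝ}
    (huμ : (IsClassicalSolution (minkowskiComb μ Ω₀ Ω₁) Fμ uμ ∧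
          ComparisonPrinciple (minkowskiComb μ Ω₀ Ω₁) Fμ) ∨
        (IsViscositySolution (minkowskiComb μ Ω₀ Ω₁) Fμ uμ ∧
          ViscosityComparisonPrinciple (minkowskiComb μ Ω₀ Ω₁) Fμ))
    (hA : AssumptionA μ p Ω₀ Ω₁ F₀ F₁ Fμ)
    (hlim : 0 < p → InwardDerivLiminfPos Ω₀ u₀ ∧ InwardDerivLiminfPos Ω₁ u₁)
    {x₀ x₁ : EucSpace n} (hx₀ : x₀ ∈ Ω₀) (hx₁ : x₁ ∈ Ω₁) :
    powMean p (u₀ x₀) (u₁ x₁) μ ≤ uμ ((1 - μ) • x₀ + μ • x₁) := by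
  have hP₀ := hu₀.toIsPositiveDirichlet
  have hP₁ := hu₁.toIsPositiveDirichlet
  have hcont := continuousOn_supConv hμ hp hΩ₀ hc₀ hb₀ hΩ₁ hc₁ hb₁ hP₀ hP₁
    (hu₀.contDiffOn.differentiableOn (by simp)) (hu₁.contDiffOn.differentiableOn (by simp)) hlim
  have hsub := isViscositySubsolution_supConv hμ hp hΩ₀ hc₀ hb₀ hΩ₁ hc₁ hb₁ hFμ hu₀ hu₁ hA hlim
  have hnn : ∀ x ∈ closure (minkowskiComb μ Ω₀ Ω₁), 0 ≤ supConv p μ Ω₀ Ω₁ u₀ u₁ x :=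
    fun x hx => supConv_nonneg hμ hp.1 hb₀ hb₁ hP₀ hP₁ hx
  have hz : ∀ x ∈ frontier (minkowskiComb μ Ω₀ Ω₁), supConv p μ Ω₀ Ω₁ u₀ u₁ x = 0 :=
    fun x hx => supConv_eq_zero hμ hp.1 hΩ₀ hΩ₁ hb₀ hb₁ hP₀ hP₁ hx.1 fun h =>
      hx.2 ((isOpen_minkowskiComb hμ hΩ₁).interior_eq.symm ▸ h)
  have hle : supConv p μ Ω₀ Ω₁ u₀ u₁ ((1 - μ) • x₀ + μ • x₁) ≤ uμ ((1 - μ) • x₀ + μ • x₁) := by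
    have hmem := comb_mem_minkowskiComb (μ := μ) (z := (x₀, x₁)) hx₀ hx₁
    rcases huμ with ⟨hs, hcomp⟩ | ⟨hs, hcomp⟩
    · exact hcomp uμ _ hs.continuousOn hcont (fun x hx => hs.nonneg hx) hnn
        ⟨hs.contDiffOn, fun x hx => (hs.equation x hx).le⟩ hsub
        (fun x hx => ((hz x hx).trans (hs.boundary x hx).symm).le) _ hmem
    · exact hcomp uμ _ hs.continuousOn hcont (fun x hx => hs.nonneg hx) hnn
        hs.supersolution hsub
        (fun x hx => ((hz x hx).trans (hs.boundary x hx).symm).le) _ hmem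
  exact (powMean_le_supConv hμ hp.1 hb₀ hb₁ hP₀ hP₁ (z := (x₀, x₁))
    ⟨subset_closure hx₀, subset_closure hx₁⟩).trans hle

end SupConvolution

/-! ### Norms of positive Dirichlet functions -/

section Norms

variable {n : ℕ} {Ω : Set (EucSpace n)} {u : EucSpace n → ℝ}

theorem IsPositiveDirichlet.exists_isMaxOn (hu : IsPositiveDirichlet Ω u)
    (hb : Bornology.IsBounded Ω) (hne : Ω.Nonempty) : ∃ x ∈ Ω, ∀ y ∈ Ω, u y ≤ u x := by
  obtain ⟨x, hx, hmax⟩ := hb.isCompact_closure.exists_isMaxOn hne.closure hu.continuousOn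
  refine ⟨x, ?_, fun y hy => hmax (subset_closure hy)⟩
  obtain ⟨y, hy⟩ := hne
  by_contra h
  exact ((hu.pos y hy).trans_le (hmax (subset_closure hy))).ne' (hu.eq_zero hx h)

theorem IsPositiveDirichlet.memLp (hu : IsPositiveDirichlet Ω u) (hΩ : IsOpen Ω)
    (hb : Bornology.IsBounded Ω) (r : ℝ≥0∞) : MemLp u r (volume.restrict Ω) := by
  rcases Ω.eq_empty_or_nonempty with rfl | hne
  · simp
  have : IsFiniteMeasure (volume.restrict Ω) := ⟨by simpa using hb.measure_lt_top⟩
  obtain ⟨x, -, hmax⟩ := hu.exists_isMaxOn hb hne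
  refine .of_bound ((hu.continuousOn.mono subset_closure).aestronglyMeasurable hΩ.measurableSet)
    (u x) (ae_restrict_of_forall_mem hΩ.measurableSet fun y hy => ?_)
  rw [Real.norm_of_nonneg (hu.pos y hy).le]
  exact hmax y hy

theorem IsPositiveDirichlet.isBoundedDensity (hu : IsPositiveDirichlet Ω u) (hΩ : IsOpen Ω)
    (hb : Bornology.IsBounded Ω) {s : ℝ} (hs : 0 < s) :
    IsBoundedDensity (Ω.indicator fun x => u x ^ s) := by
  refine ⟨?_, fun x => indicator_nonneg (fun y hy => Real.rpow_nonneg (hu.pos y hy).le _) x, ?_, ?_⟩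
  · classical
    rw [← piecewise_eq_indicator]
    have hc : ContinuousOn (fun x => u x ^ s) Ω :=
      (hu.continuousOn.mono subset_closure).rpow_const fun _ _ => .inr hs.le
    exact hc.measurable_piecewise continuousOn_const hΩ.measurableSet
  · rcases Ω.eq_empty_or_nonempty with rfl | hne
    · exact ⟨0, by simp⟩
    obtain ⟨x, hx, hmax⟩ := hu.exists_isMaxOn hb hne
    refine ⟨u x ^ s, fun y => ?_⟩
    by_cases hy : y ∈ Ω
    · rw [indicator_of_mem hy]
      exact Real.rpow_le_rpow (hu.pos y hy).le (hmax y hy) hs.le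
    · rw [indicator_of_notMem hy]
      exact Real.rpow_nonneg (hu.pos x hx).le _
  · obtain ⟨R, hR⟩ := hb.exists_norm_le
    exact ⟨R, fun x hx => hR x (mem_of_indicator_ne_zero hx)⟩

theorem IsPositiveDirichlet.lpNorm_eq (hu : IsPositiveDirichlet Ω u) (hΩ : IsOpen Ω)
    (hb : Bornology.IsBounded Ω) {r : ℝ≥0∞} (hr : r ≠ 0) (hr' : r ≠ ∞) :
    lpNorm u r (volume.restrict Ω) =
      (∫ x, Ω.indicator (fun x => u x ^ r.toReal) x) ^ (1 / r.toReal) := by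
  rw [lpNorm_eq_integral_norm_rpow_toReal hr hr' (hu.memLp hΩ hb r).1,
    integral_indicator hΩ.measurableSet, one_div]
  congr 1
  refine setIntegral_congr_fun hΩ.measurableSet fun x hx => ?_
  simp only [Real.norm_of_nonneg (hu.pos x hx).le]

theorem IsPositiveDirichlet.integral_pos (hu : IsPositiveDirichlet Ω u) (hΩ : IsOpen Ω)
    (hb : Bornology.IsBounded Ω) (hne : Ω.Nonempty) {s : ℝ} (hs : 0 < s) :
    0 < ∫ x, Ω.indicator (fun x => u x ^ s) x := by
  have hd := hu.isBoundedDensity hΩ hb hs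
  rw [integral_pos_iff_support_of_nonneg hd.nonneg hd.integrable]
  refine (hΩ.measure_pos volume hne).trans_le (measure_mono fun x hx => ?_)
  rw [Function.mem_support, indicator_of_mem hx]
  exact (Real.rpow_pos_of_pos (hu.pos x hx) s).ne'

/-- By continuity the set where `u` exceeds its essential supremum is open, so being null it is
empty. -/
theorem IsPositiveDirichlet.le_lpNorm_top (hu : IsPositiveDirichlet Ω u) (hΩ : IsOpen Ω)
    (hb : Bornology.IsBounded Ω) {x : EucSpace n} (hx : x ∈ Ω) :
    u x ≤ lpNorm u ∞ (volume.restrict Ω) := by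
  by_contra! hcon
  have hae := ae_le_lpNorm_exponent_top (hu.memLp hΩ hb ∞)
  rw [ae_restrict_iff' hΩ.measurableSet] at hae
  have hopen := (hu.continuousOn.mono subset_closure).isOpen_inter_preimage hΩ
    (isOpen_Ioi (a := lpNorm u ∞ (volume.restrict Ω)))
  refine (hopen.measure_pos volume ⟨x, hx, hcon⟩).ne' (measure_mono_null ?_ hae)
  rintro y ⟨hy, hy'⟩ h
  exact (lt_of_lt_of_le hy' (Real.le_norm_self _)).not_ge (h hy)

theorem IsPositiveDirichlet.lpNorm_top_le (hu : IsPositiveDirichlet Ω u) (hΩ : IsOpen Ω)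
    {C : ℝ} (hC : 0 ≤ C) (h : ∀ x ∈ Ω, u x ≤ C) : lpNorm u ∞ (volume.restrict Ω) ≤ C := by
  rw [← toReal_eLpNorm ((hu.continuousOn.mono subset_closure).aestronglyMeasurable
    hΩ.measurableSet), eLpNorm_exponent_top]
  refine ENNReal.toReal_le_of_le_ofReal hC (eLpNormEssSup_le_of_ae_bound ?_)
  refine ae_restrict_of_forall_mem hΩ.measurableSet fun y hy => ?_
  rw [Real.norm_of_nonneg (hu.pos y hy).le]
  exact h y hy

end Norms

/-! ### The norm inequality -/

theorem corollary4p2 (n : ℕ) (hn : 2 ≤ n) (μ p : ℝ) (hμ : μ ∈ Ioo (0 : ℝ) 1)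
    (hp : p ∈ Ico (0 : ℝ) 1)
    (Ω₀ Ω₁ : Set (EucSpace n))
    (hΩ₀_open : IsOpen Ω₀) (hΩ₀_conv : Convex ℝ Ω₀) (hΩ₀_bdd : Bornology.IsBounded Ω₀)
    (hΩ₀_ne : Ω₀.Nonempty)
    (hΩ₁_open : IsOpen Ω₁) (hΩ₁_conv : Convex ℝ Ω₁) (hΩ₁_bdd : Bornology.IsBounded Ω₁)
    (hΩ₁_ne : Ω₁.Nonempty)
    (F₀ F₁ Fμ : SecondOrderOp n)
    (hF₀ : IsProperElliptic Ω₀ F₀) (hF₁ : IsProperElliptic Ω₁ F₁)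
    (hFμ : IsProperElliptic (minkowskiComb μ Ω₀ Ω₁) Fμ)
    (u₀ u₁ uμ : EucSpace n → ℝ)
    (hu₀ : IsClassicalSolution Ω₀ F₀ u₀) (hu₁ : IsClassicalSolution Ω₁ F₁ u₁)
    (huμ : (IsClassicalSolution (minkowskiComb μ Ω₀ Ω₁) Fμ uμ ∧
          ComparisonPrinciple (minkowskiComb μ Ω₀ Ω₁) Fμ) ∨
        (IsViscositySolution (minkowskiComb μ Ω₀ Ω₁) Fμ uμ ∧
          ViscosityComparisonPrinciple (minkowskiComb μ Ω₀ Ω₁) Fμ))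
    (hA : AssumptionA μ p Ω₀ Ω₁ F₀ F₁ Fμ)
    (hlim : 0 < p → InwardDerivLiminfPos Ω₀ u₀ ∧ InwardDerivLiminfPos Ω₁ u₁)
    (r : ℝ≥0∞) (hr : 0 < r) :
    MemLp u₀ r (volume.restrict Ω₀) ∧ MemLp u₁ r (volume.restrict Ω₁) ∧
      MemLp uμ r (volume.restrict (minkowskiComb μ Ω₀ Ω₁)) ∧
      powMean (normMeanExponent n p r)
          (lpNorm u₀ r (volume.restrict Ω₀)) (lpNorm u₁ r (volume.restrict Ω₁)) μ ≤
        lpNorm uμ r (volume.restrict (minkowskiComb μ Ω₀ Ω₁)) := by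
  have hP₀ := hu₀.toIsPositiveDirichlet
  have hP₁ := hu₁.toIsPositiveDirichlet
  have hPμ : IsPositiveDirichlet (minkowskiComb μ Ω₀ Ω₁) uμ :=
    huμ.elim (fun h => h.1.toIsPositiveDirichlet) fun h => h.1.toIsPositiveDirichlet
  have hΩμ : IsOpen (minkowskiComb μ Ω₀ Ω₁) := isOpen_minkowskiComb hμ hΩ₁_open
  have hbμ : Bornology.IsBounded (minkowskiComb μ Ω₀ Ω₁) :=
    (hΩ₀_bdd.smul₀ (1 - μ)).add (hΩ₁_bdd.smul₀ μ)
  refine ⟨hP₀.memLp hΩ₀_open hΩ₀_bdd r, hP₁.memLp hΩ₁_open hΩ₁_bdd r, hPμ.memLp hΩμ hbμ r, ?_⟩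
  have key : ∀ x₀ ∈ Ω₀, ∀ x₁ ∈ Ω₁, powMean p (u₀ x₀) (u₁ x₁) μ ≤ uμ ((1 - μ) • x₀ + μ • x₁) :=
    fun x₀ hx₀ x₁ hx₁ => powMean_le_solution hμ hp hΩ₀_open hΩ₀_conv hΩ₀_bdd hΩ₁_open hΩ₁_conv
      hΩ₁_bdd hFμ hu₀ hu₁ huμ hA hlim hx₀ hx₁
  have hmem : ∀ x₀ ∈ Ω₀, ∀ x₁ ∈ Ω₁, (1 - μ) • x₀ + μ • x₁ ∈ minkowskiComb μ Ω₀ Ω₁ :=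
    fun x₀ hx₀ x₁ hx₁ => comb_mem_minkowskiComb (z := (x₀, x₁)) hx₀ hx₁
  by_cases hr' : r = ∞
  · subst hr'
    rw [normMeanExponent, if_pos rfl]
    obtain ⟨x₀, hx₀, hm₀⟩ := hP₀.exists_isMaxOn hΩ₀_bdd hΩ₀_ne
    obtain ⟨x₁, hx₁, hm₁⟩ := hP₁.exists_isMaxOn hΩ₁_bdd hΩ₁_ne
    calc _ ≤ powMean p (u₀ x₀) (u₁ x₁) μ := powMean_mono hμ hp.1 lpNorm_nonneg lpNorm_nonneg
          (hP₀.lpNorm_top_le hΩ₀_open (hP₀.pos _ hx₀).le hm₀)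
          (hP₁.lpNorm_top_le hΩ₁_open (hP₁.pos _ hx₁).le hm₁)
      _ ≤ _ := key x₀ hx₀ x₁ hx₁
      _ ≤ _ := hPμ.le_lpNorm_top hΩμ hbμ (hmem x₀ hx₀ x₁ hx₁)
  · have hs : 0 < r.toReal := ENNReal.toReal_pos hr.ne' hr'
    rw [normMeanExponent, if_neg hr', hP₀.lpNorm_eq hΩ₀_open hΩ₀_bdd hr.ne' hr',
      hP₁.lpNorm_eq hΩ₁_open hΩ₁_bdd hr.ne' hr', hPμ.lpNorm_eq hΩμ hbμ hr.ne' hr']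
    set s := r.toReal
    have d₀ := hP₀.isBoundedDensity hΩ₀_open hΩ₀_bdd hs
    have d₁ := hP₁.isBoundedDensity hΩ₁_open hΩ₁_bdd hs
    have I₀ := hP₀.integral_pos hΩ₀_open hΩ₀_bdd hΩ₀_ne hs
    have I₁ := hP₁.integral_pos hΩ₁_open hΩ₁_bdd hΩ₁_ne hs
    have hp0 := hp.1
    -- Taking `s`-th powers turns the `p`-mean into a `p/s`-mean; taking the `1/s` power afterwards
    -- multiplies the resulting exponent by `s`, which gives `ps/(np+s)`.
    have bbl := powMean_integral_le (p := p / s) hμ (by positivity) d₀ d₁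
      (hPμ.isBoundedDensity hΩμ hbμ hs) (fun x y hx hy => ?_) I₀ I₁
    · have he : p / s / (n * (p / s) + 1) / (1 / s) = p * s / (n * p + s) := by
        field_simp
      rw [← he, ← powMean_rpow hμ (by positivity) (by positivity) I₀.le I₁.le]
      exact Real.rpow_le_rpow (powMean_nonneg hμ (by positivity) I₀.le I₁.le) bbl (by positivity)
    · have hx' : x ∈ Ω₀ := mem_of_indicator_ne_zero hx.ne'
      have hy' : y ∈ Ω₁ := mem_of_indicator_ne_zero hy.ne'
      rw [indicator_of_mem hx', indicator_of_mem hy', indicator_of_mem (hmem x hx' y hy'),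
        ← powMean_rpow hμ hp.1 hs (hP₀.pos x hx').le (hP₁.pos y hy').le]
      exact Real.rpow_le_rpow (powMean_nonneg hμ hp.1 (hP₀.pos x hx').le (hP₁.pos y hy').le)
        (key x hx' y hy') hs.le
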